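/- Suppose that $4\le N\le 10$. Then the equation $$\Delta U+e^U=0\quad\text{in }\mathbb R^N\setminus\{0\}$$ has countably infinitely many nonradial singular solutions of the form $$U(R,\sigma)=-2\log R+\log\bigl(2(N-2)\bigr)+V(\sigma),\qquad (R,\sigma)\in(0,\infty)\times\mathbb S^{N-1},$$ with $V$ nonconstant on $\mathbb S^{N-1}$, where $(R,\sigma)$ are the spherical polar coordinates. That is, there are sequences $(U_j)_{j\in\mathbb N}$ and $(V_j)_{j\in\mathbb N}$ such that each $U_j$ is a classical ($C^2$) solution of the equation in $\mathbb R^N\setminus\{0\}$, satisfies $U_j(x)\to+\infty$ as $x\to0$, is not a function of $|x|$ alone, and has the above form with $V=V_j$ nonconstant; and for $i\ne j$ the solutions $U_i$ and $U_j$ are distinct, even up to a linear isometry of $\mathbb R^N$ (there is no linear isometry $Q$ with $U_i=U_j\circ Q$ on $\mathbb R^N\setminus\{0\}$). -/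

import Mathlib

open scoped Laplacian

/-- `U` is a classical solution of `ΔU + e^U = 0` in `ℝ^N ∖ {0}`: it is twice continuously
differentiable there and satisfies the equation at every point (the value of `U` at the origin
plays no role). -/
def IsSolutionAwayFromOrigin {N : ℕ} (U : EuclideanSpace ℝ (Fin N) → ℝ) : Prop :=
  ContDiffOn ℝ 2 U {0}ᶜ ∧ ∀ x : EuclideanSpace ℝ (Fin N), x ≠ 0 → (Δ U) x + Real.exp (U x) = 0

/-- `U` is singular at the origin: it blows up there. -/
def IsSingularAtOrigin {N : ℕ} (U : EuclideanSpace ℝ (Fin N) → ℝ) : Prop :=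
  Filter.Tendsto U (nhdsWithin 0 {0}ᶜ) Filter.atTop

/-- `U` is radial on `ℝ^N ∖ {0}`: it depends on the norm only. -/
def IsRadialAwayFromOrigin {N : ℕ} (U : EuclideanSpace ℝ (Fin N) → ℝ) : Prop :=
  ∃ f : ℝ → ℝ, ∀ x : EuclideanSpace ℝ (Fin N), x ≠ 0 → U x = f ‖x‖

/-- In polar coordinates `x = R σ`, `R > 0`, `σ ∈ 𝕊^{N-1}`, the function `U` has the form
`U(R, σ) = -2 log R + log (2 (N - 2)) + V(σ)`. -/
def HasSeparatedForm {N : ℕ} (U : EuclideanSpace ℝ (Fin N) → ℝ)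
    (V : Metric.sphere (0 : EuclideanSpace ℝ (Fin N)) 1 → ℝ) : Prop :=
  ∀ (R : ℝ) (σ : Metric.sphere (0 : EuclideanSpace ℝ (Fin N)) 1), 0 < R →
    U (R • (σ : EuclideanSpace ℝ (Fin N))) =
      -2 * Real.log R + Real.log (2 * ((N : ℝ) - 2)) + V σ

/-- `U₁` and `U₂` agree on `ℝ^N ∖ {0}` up to a linear isometry of `ℝ^N` (a rotation or
reflection fixing the origin). The identity is one, so functions that agree on `ℝ^N ∖ {0}`
are congruent. -/
def CongruentAwayFromOrigin {N : ℕ} (U₁ U₂ : EuclideanSpace ℝ (Fin N) → ℝ) : Prop :=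
  ∃ Q : EuclideanSpace ℝ (Fin N) ≃ₗᵢ[ℝ] EuclideanSpace ℝ (Fin N),
    ∀ x : EuclideanSpace ℝ (Fin N), x ≠ 0 → U₁ x = U₂ (Q x)

/-! Look for `V = f (cos θ)`, with `θ` the angle to a fixed axis, symmetric about the equator. With
`N = m + 3` and `x = 1 - cos θ` the equation becomes `x(2-x)v'' + (m+2)(1-x)v' + 2(m+1)(e^v - 1) =
0`. It is solved by shooting: for each `a > 0` there is a solution regular at the pole with `v 0 =
a` (`exists_regular_family`), and it extends by reflection to the whole sphere when `v' 1 = 0`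
(`exists_even_extension`). So infinitely many such `a` are needed.

Compare `v` with the solution `log (m/(m+1)) - 2 log (sin θ)`, which is singular at the pole. The
coordinates `A = ((m+1)/m) x(2-x) e^v - 1` and `P = x(2-x) (log (1 + A))'` send the singular
solution to the origin and every regular solution to a curve issuing from `(-1, 2)`, and `P 1 = v'
1`. As `x → 0` the system linearised at the origin has, up to time scale, characteristic equation
`λ² + mλ + 2m = 0`. Its roots are nonreal with negative real part exactly for `0 < m < 8`, that is
for `4 ≤ N ≤ 10`: the origin is then a stable focus.

At `x = e^{-a}` the energy of the curve is bounded independently of `a` (`phaseEnergy_exp_neg_le`).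
For large `a` the remaining logarithmic time is long, so dissipation brings the curve close to the
origin while `x` is still small (`exists_sq_add_sq_lt`), and from there it keeps rotating at a
definite rate in `log x` (`angle_one_le`). Its polar angle at the equator thus tends to `-∞` as `a →
∞`. The curve never meets the origin (`ne_zero`), so this angle is continuous in `a`; it takes
values in `πℤ`, where `P 1 = 0`, for arbitrarily large `a`. Finally `a = f 1` is the maximum of `f`,
so different `a` give noncongruent solutions. -/

/-! ### Integral equations with a parameter: contraction in a weighted norm -/

theorem abs_integral_le_exp_weight {f : ℝ → ℝ} {B l : ℝ} (hl : 0 < l)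
    (hf : ∀ y, |f y| ≤ B * Real.exp (l * |y|)) (x : ℝ) :
    |∫ y in (0 : ℝ)..x, f y| ≤ B / l * Real.exp (l * |x|) := by
  have hB : 0 ≤ B := by simpa using (abs_nonneg _).trans (hf 0)
  have key : ∀ h : ℝ → ℝ, (∀ y, |h y| ≤ B * Real.exp (l * |y|)) → ∀ X, 0 ≤ X →
      |∫ y in (0 : ℝ)..X, h y| ≤ B / l * Real.exp (l * X) := by
    intro h hh X hX
    have hd : ∀ y : ℝ, HasDerivAt (fun y => B / l * Real.exp (l * y)) (B * Real.exp (l * y)) y := by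
      intro y
      have := (((hasDerivAt_id y).const_mul l).exp).const_mul (B / l)
      refine this.congr_deriv ?_
      simp only [id]
      field_simp
    have hint : ∫ y in (0 : ℝ)..X, B * Real.exp (l * y)
        = B / l * Real.exp (l * X) - B / l * Real.exp (l * 0) :=
      intervalIntegral.integral_eq_sub_of_hasDerivAt (fun y _ => hd y)
        ((by fun_prop : Continuous fun y => B * Real.exp (l * y)).intervalIntegrable _ _)
    have := intervalIntegral.norm_integral_le_of_norm_le (f := h)
      (g := fun y => B * Real.exp (l * y)) (μ := MeasureTheory.volume) hX
      (Filter.Eventually.of_forall fun y hy => by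
        have := hh y
        rwa [abs_of_pos hy.1] at this)
      ((by fun_prop : Continuous fun y => B * Real.exp (l * y)).intervalIntegrable _ _)
    rw [hint] at this
    have h0 : 0 ≤ B / l * Real.exp (l * 0) := by positivity
    exact this.trans (by linarith)
  rcases le_total 0 x with hx | hx
  · simpa [abs_of_nonneg hx] using key f hf x hx
  · have h1 := key (fun y => f (-y)) (fun y => by simpa using hf (-y)) (-x) (by linarith)
    rw [intervalIntegral.integral_comp_neg] at h1
    rw [abs_of_nonpos hx, intervalIntegral.integral_symm, abs_neg]
    simpa using h1

/-- A family of integral equations of pantograph type with Lipschitz nonlinearity has a solution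
that is jointly continuous in the initial value and the variable. -/
theorem exists_continuous_family_integral_eq (K g : ℝ → ℝ → ℝ) (L : ℝ → ℝ) (M : ℝ) (hM : 0 < M)
    (hK : Continuous (Function.uncurry K)) (hKM : ∀ y, ∀ u ∈ Set.Icc (0 : ℝ) 1, |K y u| ≤ M)
    (hL : Continuous L) (hL0 : ∀ a, 0 < L a)
    (hg : Continuous (Function.uncurry g))
    (hgL : ∀ a s t, |g a s - g a t| ≤ L a * |s - t|) (hg0 : ∀ a, |g a a| ≤ L a) :
    ∃ V : ℝ → ℝ → ℝ, Continuous (Function.uncurry V) ∧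
      ∀ a x, V a x = a + ∫ y in (0 : ℝ)..x, ∫ u in (0 : ℝ)..1, K y u * g a (V a (y * u)) := by
  -- Integration gains a factor `1 / l a` against the weight `exp (l a * |x|)`, while the integrand
  -- has Lipschitz constant `M * L a`; this choice gives contraction constant `1/2` for all `a` at
  -- once.
  set l : ℝ → ℝ := fun a => 2 * M * L a with hl
  have hl0 : ∀ a, 0 < l a := fun a => by have := hL0 a; positivity
  have hlc : Continuous l := by fun_prop
  -- The unknown of the fixed point problem is the weighted deviation from `a`, as a bounded
  -- continuous function of the pair `(a, x)`; joint continuity in `a` and `x` then comes for free.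
  let W : (BoundedContinuousFunction (ℝ × ℝ) ℝ) → ℝ → ℝ → ℝ :=
    fun v a x => a + Real.exp (l a * |x|) * v (a, x)
  have hWc : ∀ v, Continuous (Function.uncurry (W v)) := by
    intro v
    have := v.continuous
    simp only [W, Function.uncurry_def]
    fun_prop
  let J : (BoundedContinuousFunction (ℝ × ℝ) ℝ) → ℝ → ℝ → ℝ :=
    fun v a y => ∫ u in (0 : ℝ)..1, K y u * g a (W v a (y * u))
  have hFc : ∀ v, Continuous (Function.uncurry fun (p : ℝ × ℝ) (u : ℝ) =>
      K p.2 u * g p.1 (W v p.1 (p.2 * u))) := by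
    intro v
    have h1 : Continuous fun q : (ℝ × ℝ) × ℝ => K q.1.2 q.2 :=
      hK.comp (by fun_prop : Continuous fun q : (ℝ × ℝ) × ℝ => (q.1.2, q.2))
    have h2 : Continuous fun q : (ℝ × ℝ) × ℝ => W v q.1.1 (q.1.2 * q.2) :=
      (hWc v).comp (by fun_prop : Continuous fun q : (ℝ × ℝ) × ℝ => (q.1.1, q.1.2 * q.2))
    have h3 : Continuous fun q : (ℝ × ℝ) × ℝ => g q.1.1 (W v q.1.1 (q.1.2 * q.2)) :=
      hg.comp ((by fun_prop : Continuous fun q : (ℝ × ℝ) × ℝ => q.1.1).prodMk h2)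
    exact h1.mul h3
  have hJc : ∀ v, Continuous (Function.uncurry (J v)) := fun v =>
    intervalIntegral.continuous_parametric_intervalIntegral_of_continuous' (hFc v) 0 1
  have hFi : ∀ v a y, IntervalIntegrable (fun u => K y u * g a (W v a (y * u)))
      MeasureTheory.volume 0 1 := fun v a y =>
    ((hFc v).comp (by fun_prop : Continuous fun u : ℝ => ((a, y), u))).intervalIntegrable _ _
  have habs : ∀ {y u : ℝ}, u ∈ Set.Icc (0 : ℝ) 1 → ∀ a,
      Real.exp (l a * |y * u|) ≤ Real.exp (l a * |y|) := by
    intro y u hu a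
    refine Real.exp_le_exp.2 (mul_le_mul_of_nonneg_left ?_ (hl0 a).le)
    rw [abs_mul, abs_of_nonneg hu.1]
    exact mul_le_of_le_one_right (abs_nonneg _) hu.2
  have hIcc : ∀ {u : ℝ}, u ∈ Set.uIoc (0 : ℝ) 1 → u ∈ Set.Icc (0 : ℝ) 1 := by
    intro u hu
    rw [Set.uIoc_of_le zero_le_one] at hu
    exact ⟨hu.1.le, hu.2⟩
  have hJd : ∀ v w a y, |J v a y - J w a y| ≤ M * L a * ‖v - w‖ * Real.exp (l a * |y|) := by
    intro v w a y
    simp only [J]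
    rw [← intervalIntegral.integral_sub (hFi v a y) (hFi w a y)]
    have := intervalIntegral.norm_integral_le_of_norm_le_const (a := (0 : ℝ)) (b := 1)
      (f := fun u => K y u * g a (W v a (y * u)) - K y u * g a (W w a (y * u)))
      (C := M * L a * ‖v - w‖ * Real.exp (l a * |y|)) (by
        intro u hu
        have hu' := hIcc hu
        rw [← mul_sub, Real.norm_eq_abs, abs_mul]
        have h1 : |W v a (y * u) - W w a (y * u)| ≤ Real.exp (l a * |y|) * ‖v - w‖ := by
          have : W v a (y * u) - W w a (y * u)
              = Real.exp (l a * |y * u|) * (v - w) (a, y * u) := by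
            simp only [W, BoundedContinuousFunction.sub_apply]; ring
          rw [this, abs_mul, Real.abs_exp]
          exact mul_le_mul (habs hu' a) ((v - w).norm_coe_le_norm _) (abs_nonneg _)
            (Real.exp_nonneg _)
        calc |K y u| * |g a (W v a (y * u)) - g a (W w a (y * u))|
            ≤ M * (L a * (Real.exp (l a * |y|) * ‖v - w‖)) := by
              refine mul_le_mul (hKM y u hu') ((hgL _ _ _).trans ?_) (abs_nonneg _) hM.le
              exact mul_le_mul_of_nonneg_left h1 (hL0 a).le
          _ = _ := by ring)
    simpa using this
  have hJ0 : ∀ a y, |J 0 a y| ≤ M * L a * Real.exp (l a * |y|) := by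
    intro a y
    have := intervalIntegral.norm_integral_le_of_norm_le_const (a := (0 : ℝ)) (b := 1)
      (f := fun u => K y u * g a (W 0 a (y * u)))
      (C := M * L a * Real.exp (l a * |y|)) (by
        intro u hu
        rw [Real.norm_eq_abs, abs_mul]
        have h1 : W 0 a (y * u) = a := by simp [W]
        rw [h1]
        have h2 : (1 : ℝ) ≤ Real.exp (l a * |y|) :=
          Real.one_le_exp (mul_nonneg (hl0 a).le (abs_nonneg _))
        have h3 : 0 ≤ M * L a := (mul_pos hM (hL0 a)).le
        calc |K y u| * |g a a| ≤ M * L a :=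
              mul_le_mul (hKM y u (hIcc hu)) (hg0 a) (abs_nonneg _) hM.le
          _ ≤ _ := le_mul_of_one_le_right h3 h2)
    simpa using this
  have hJb : ∀ v a y, |J v a y| ≤ M * L a * (1 + ‖v‖) * Real.exp (l a * |y|) := by
    intro v a y
    have h1 := hJd v 0 a y
    have h2 := hJ0 a y
    rw [sub_zero] at h1
    calc |J v a y| = |(J v a y - J 0 a y) + J 0 a y| := by ring_nf
      _ ≤ _ := abs_add_le _ _
      _ ≤ _ := add_le_add h1 h2
      _ = _ := by ring
  have hratio : ∀ a c, M * L a * c / l a = c / 2 := by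
    intro a c
    have := hL0 a
    simp only [hl]; field_simp
  let T0 : (BoundedContinuousFunction (ℝ × ℝ) ℝ) → ℝ × ℝ → ℝ :=
    fun v p => Real.exp (-(l p.1 * |p.2|)) * ∫ y in (0 : ℝ)..p.2, J v p.1 y
  have hT0c : ∀ v, Continuous (T0 v) := by
    intro v
    have h1 : Continuous fun p : ℝ × ℝ => ∫ y in (0 : ℝ)..p.2, J v p.1 y :=
      intervalIntegral.continuous_parametric_intervalIntegral_of_continuous
        (f := fun (p : ℝ × ℝ) y => J v p.1 y)
        ((hJc v).comp (by fun_prop : Continuous fun q : (ℝ × ℝ) × ℝ => (q.1.1, q.2)))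
        continuous_snd
    have h2 : Continuous fun p : ℝ × ℝ => Real.exp (-(l p.1 * |p.2|)) := by fun_prop
    exact h2.mul h1
  have hweight : ∀ a x C I : ℝ, |I| ≤ C / 2 * Real.exp (l a * |x|) →
      |Real.exp (-(l a * |x|)) * I| ≤ C / 2 := by
    intro a x C I h
    rw [abs_mul, Real.abs_exp, Real.exp_neg, inv_mul_le_iff₀ (Real.exp_pos _), mul_comm]
    exact h
  let T : (BoundedContinuousFunction (ℝ × ℝ) ℝ) → (BoundedContinuousFunction (ℝ × ℝ) ℝ) :=
    fun v => BoundedContinuousFunction.ofNormedAddCommGroup (T0 v) (hT0c v) ((1 + ‖v‖) / 2) (by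
      rintro ⟨a, x⟩
      refine hweight a x _ _ ?_
      rw [← hratio a]
      exact abs_integral_le_exp_weight (hl0 a) (hJb v a) x)
  have hT : ContractingWith (1 / 2 : NNReal) T := by
    refine ⟨by norm_num, LipschitzWith.of_dist_le_mul fun v w => ?_⟩
    rw [BoundedContinuousFunction.dist_le (by positivity)]
    rintro ⟨a, x⟩
    have hi : ∀ v, IntervalIntegrable (J v a) MeasureTheory.volume 0 x := fun v =>
      ((hJc v).comp (by fun_prop : Continuous fun y : ℝ => (a, y))).intervalIntegrable _ _
    have : T v (a, x) - T w (a, x)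
        = Real.exp (-(l a * |x|)) * ∫ y in (0 : ℝ)..x, (J v a y - J w a y) := by
      rw [intervalIntegral.integral_sub (hi v) (hi w), mul_sub]
      rfl
    rw [Real.dist_eq, this, dist_eq_norm]
    have h := hweight a x ‖v - w‖ _ (by
      rw [← hratio a]
      exact abs_integral_le_exp_weight (hl0 a) (hJd v w a) x)
    refine h.trans (le_of_eq ?_)
    push_cast; ring
  set v := ContractingWith.fixedPoint T hT with hv
  have hfix : T v = v := hT.fixedPoint_isFixedPt
  refine ⟨W v, hWc v, fun a x => ?_⟩
  have h1 : v (a, x) = Real.exp (-(l a * |x|)) * ∫ y in (0 : ℝ)..x, J v a y := by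
    conv_lhs => rw [← hfix]
    rfl
  change a + Real.exp (l a * |x|) * v (a, x) = a + ∫ y in (0 : ℝ)..x, J v a y
  rw [h1, ← mul_assoc, ← Real.exp_add]
  simp

theorem hasDerivAt_integral_of_continuous_deriv {F F' : ℝ → ℝ → ℝ} {a b : ℝ}
    (hF : Continuous (Function.uncurry F)) (hF' : Continuous (Function.uncurry F'))
    (hd : ∀ x ∈ Set.Ioo a b, ∀ u ∈ Set.Icc (0 : ℝ) 1, HasDerivAt (fun x => F x u) (F' x u) x)
    {x : ℝ} (hx : x ∈ Set.Ioo a b) :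
    HasDerivAt (fun x => ∫ u in (0 : ℝ)..1, F x u) (∫ u in (0 : ℝ)..1, F' x u) x := by
  obtain ⟨B, hB⟩ := (isCompact_Icc.prod isCompact_Icc :
    IsCompact (Set.Icc a b ×ˢ Set.Icc (0 : ℝ) 1)).exists_bound_of_continuousOn hF'.continuousOn
  have hIcc : ∀ {u : ℝ}, u ∈ Set.uIoc (0 : ℝ) 1 → u ∈ Set.Icc (0 : ℝ) 1 := by
    intro u hu
    rw [Set.uIoc_of_le zero_le_one] at hu
    exact ⟨hu.1.le, hu.2⟩
  have hFx : ∀ x, Continuous (F x) := fun x => hF.comp (by fun_prop : Continuous fun u => (x, u))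
  have hFx' : ∀ x, Continuous (F' x) :=
    fun x => hF'.comp (by fun_prop : Continuous fun u => (x, u))
  exact (intervalIntegral.hasDerivAt_integral_of_dominated_loc_of_deriv_le
    (bound := fun _ => B) (isOpen_Ioo.mem_nhds hx)
    (Filter.Eventually.of_forall fun y => (hFx y).aestronglyMeasurable)
    ((hFx x).intervalIntegrable _ _) (hFx' x).aestronglyMeasurable
    (Filter.Eventually.of_forall fun u hu y hy =>
      hB (y, u) ⟨Set.Ioo_subset_Icc_self hy, hIcc hu⟩)
    (by simp) (Filter.Eventually.of_forall fun u hu y hy => hd y hy u (hIcc hu))).2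

/-! ### The truncated exponential: a globally Lipschitz nonlinearity -/

/-- `s ↦ e^s - 1`, continued linearly beyond `s = a`. -/
noncomputable def truncExp (a s : ℝ) : ℝ :=
  Real.exp a - 1 + ∫ r in a..s, Real.exp (min r a)

theorem continuous_truncExp : Continuous (Function.uncurry truncExp) := by
  have h : Continuous fun p : ℝ × ℝ => ∫ r in (0 : ℝ)..(p.2 - p.1), Real.exp (min (r + p.1) p.1) :=
    intervalIntegral.continuous_parametric_intervalIntegral_of_continuous
      (f := fun (p : ℝ × ℝ) r => Real.exp (min (r + p.1) p.1)) (by fun_prop) (by fun_prop)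
  have : Function.uncurry truncExp = fun p : ℝ × ℝ =>
      Real.exp p.1 - 1 + ∫ r in (0 : ℝ)..(p.2 - p.1), Real.exp (min (r + p.1) p.1) := by
    ext ⟨a, s⟩
    simp only [Function.uncurry_apply_pair, truncExp]
    rw [intervalIntegral.integral_comp_add_right (fun r => Real.exp (min r a))]
    simp
  rw [this]
  fun_prop

theorem hasDerivAt_truncExp (a s : ℝ) : HasDerivAt (truncExp a) (Real.exp (min s a)) s := by
  have hc : Continuous fun r : ℝ => Real.exp (min r a) := by fun_prop
  exact (intervalIntegral.integral_hasDerivAt_right (hc.intervalIntegrable _ _)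
    (hc.stronglyMeasurableAtFilter _ _) hc.continuousAt).const_add _

theorem truncExp_of_le {a s : ℝ} (h : s ≤ a) : truncExp a s = Real.exp s - 1 := by
  have : ∫ r in a..s, Real.exp (min r a) = ∫ r in a..s, Real.exp r := by
    refine intervalIntegral.integral_congr fun r hr => ?_
    rw [Set.uIcc_of_ge h] at hr
    simp only [min_eq_left hr.2]
  rw [truncExp, this, integral_exp]
  ring

theorem abs_truncExp_sub_le (a s t : ℝ) :
    |truncExp a s - truncExp a t| ≤ Real.exp a * |s - t| := by
  have hc : Continuous fun r : ℝ => Real.exp (min r a) := by fun_prop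
  have : truncExp a s - truncExp a t = ∫ r in t..s, Real.exp (min r a) := by
    rw [truncExp, truncExp, add_sub_add_left_eq_sub, intervalIntegral.integral_interval_sub_left
      (hc.intervalIntegrable _ _) (hc.intervalIntegrable _ _)]
  rw [this]
  rw [← Real.norm_eq_abs]
  refine intervalIntegral.norm_integral_le_of_norm_le_const fun r _ => ?_
  rw [Real.norm_eq_abs, Real.abs_exp]
  exact Real.exp_le_exp.2 (min_le_right _ _)

theorem truncExp_pos {a s : ℝ} (ha : 0 < a) (h : a ≤ s) : 0 < truncExp a s := by
  have h1 : 0 ≤ ∫ r in a..s, Real.exp (min r a) :=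
    intervalIntegral.integral_nonneg h fun r _ => (Real.exp_pos _).le
  have h2 : 1 < Real.exp a := Real.one_lt_exp_iff.2 ha
  rw [truncExp]; linarith

/-! ### Regular solutions at the pole -/

/-- Projection of the real line onto `[-1, 3/2]`. -/
noncomputable def clampPole (y : ℝ) : ℝ := max (-1) (min y (3 / 2))

theorem clampPole_mem (y : ℝ) : clampPole y ∈ Set.Icc (-1 : ℝ) (3 / 2) :=
  ⟨le_max_left _ _, max_le (by norm_num) (min_le_right _ _)⟩

theorem clampPole_of_mem {y : ℝ} (h : y ∈ Set.Icc (-1 : ℝ) (3 / 2)) : clampPole y = y := by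
  rw [clampPole, min_eq_left h.2, max_eq_right h.1]

@[fun_prop]
theorem continuous_clampPole : Continuous clampPole := by unfold clampPole; fun_prop

/-- Kernel of the integrated regular solution at the pole. -/
noncomputable def poleKernel (m : ℕ) (x u : ℝ) : ℝ :=
  -(2 * ((m : ℝ) + 1)) * (u ^ ((m : ℝ) / 2) * (((2 - x * u) / (2 - x)) ^ ((m : ℝ) / 2) / (2 - x)))

/-- Derivative of `poleKernel` in the first variable. -/
noncomputable def poleKernelDeriv (m : ℕ) (x u : ℝ) : ℝ :=
  -(2 * ((m : ℝ) + 1)) * (u ^ ((m : ℝ) / 2) *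
    (((2 - 2 * u) / (2 - x) ^ 2 * ((m : ℝ) / 2) * ((2 - x * u) / (2 - x)) ^ ((m : ℝ) / 2 - 1)
        * (2 - x) + ((2 - x * u) / (2 - x)) ^ ((m : ℝ) / 2)) / (2 - x) ^ 2))

theorem hasDerivAt_poleKernel (m : ℕ) {x u : ℝ} (hx : x < 2) (hu : u ∈ Set.Icc (0 : ℝ) 1) :
    HasDerivAt (fun x => poleKernel m x u) (poleKernelDeriv m x u) x := by
  have h2 : 0 < 2 - x := by linarith
  have hpos : 0 < (2 - x * u) / (2 - x) := by
    apply div_pos _ h2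
    rcases le_total 0 x with h | h <;> nlinarith [hu.1, hu.2]
  have hn : HasDerivAt (fun x : ℝ => 2 - x * u) (-u) x := by
    simpa using ((hasDerivAt_id x).mul_const u).const_sub 2
  have hdn : HasDerivAt (fun x : ℝ => 2 - x) (-1) x := by
    simpa using (hasDerivAt_id x).const_sub 2
  have h := ((((hn.div hdn h2.ne').rpow_const (p := (m : ℝ) / 2) (Or.inl hpos.ne')).div hdn
    h2.ne').const_mul (u ^ ((m : ℝ) / 2))).const_mul (-(2 * ((m : ℝ) + 1)))
  refine h.congr_deriv ?_
  simp only [poleKernelDeriv, Pi.div_apply]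
  ring

theorem continuous_poleKernel_clamp (m : ℕ) :
    Continuous (Function.uncurry fun y u => poleKernel m (clampPole y) u) := by
  have h2 : ∀ p : ℝ × ℝ, 2 - clampPole p.1 ≠ 0 := fun p => by
    have := (clampPole_mem p.1).2
    linarith
  have hm : (0 : ℝ) ≤ (m : ℝ) / 2 := by positivity
  simp only [Function.uncurry_def, poleKernel]
  refine continuous_const.mul ((continuous_snd.rpow_const fun _ => Or.inr hm).mul
    (Continuous.div (Continuous.rpow_const (Continuous.div (by fun_prop) (by fun_prop) h2)
      fun _ => Or.inr hm) (by fun_prop) h2))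

/-- The exponent `m / 2 - 1` can be negative, so the base must not vanish. This is ensured only for
`u ∈ [0, 1]`, which is why the second variable is clamped as well. -/
theorem continuous_poleKernelDeriv_clamp (m : ℕ) :
    Continuous (Function.uncurry fun y u =>
      poleKernelDeriv m (clampPole y) (max 0 (min u 1))) := by
  have h2' : ∀ p : ℝ × ℝ, 0 < 2 - clampPole p.1 := fun p => by
    have := (clampPole_mem p.1).2
    linarith
  have h2 : ∀ p : ℝ × ℝ, 2 - clampPole p.1 ≠ 0 := fun p => (h2' p).ne'
  have h3 : ∀ p : ℝ × ℝ, (2 - clampPole p.1) ^ 2 ≠ 0 := fun p => pow_ne_zero 2 (h2 p)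
  have hm : (0 : ℝ) ≤ (m : ℝ) / 2 := by positivity
  have hpos : ∀ p : ℝ × ℝ,
      (2 - clampPole p.1 * max 0 (min p.2 1)) / (2 - clampPole p.1) ≠ 0 := fun p => by
    refine (div_pos ?_ (h2' p)).ne'
    have h4 : 0 ≤ max 0 (min p.2 1) := le_max_left _ _
    have h5 : max 0 (min p.2 1) ≤ 1 := max_le zero_le_one (min_le_right _ _)
    have := h2' p
    rcases le_total 0 (clampPole p.1) with h | h <;> nlinarith
  have hq : Continuous fun p : ℝ × ℝ =>
      (2 - clampPole p.1 * max 0 (min p.2 1)) / (2 - clampPole p.1) :=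
    Continuous.div (by fun_prop) (by fun_prop) h2
  simp only [Function.uncurry_def, poleKernelDeriv]
  refine continuous_const.mul ((Continuous.rpow_const (by fun_prop) fun _ => Or.inr hm).mul
    (Continuous.div (Continuous.add (Continuous.mul (Continuous.mul (Continuous.mul
      (Continuous.div (by fun_prop) (by fun_prop) h3) continuous_const)
      (hq.rpow_const fun p => Or.inl (hpos p))) (by fun_prop))
      (hq.rpow_const fun _ => Or.inr hm)) (by fun_prop) h3))

/-- Substitute `y = x * u`. This is the origin of the kernel: the equation in divergence form is
`((x(2-x))^(m/2+1) v')' = -2(m+1) (x(2-x))^(m/2) g(v)`, and dividing its integral by the weight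
leaves an integral over `[0, 1]` with no singularity at `x = 0`. -/
theorem integral_poleKernel (m : ℕ) {x : ℝ} (hx0 : 0 < x) (hx2 : x < 2) (h : ℝ → ℝ) :
    (x * (2 - x)) ^ ((m : ℝ) / 2) * (x * (2 - x)) * ∫ u in (0 : ℝ)..1, poleKernel m x u * h (x * u)
      = ∫ y in (0 : ℝ)..x, (y * (2 - y)) ^ ((m : ℝ) / 2) * (-(2 * ((m : ℝ) + 1)) * h y) := by
  have hs := intervalIntegral.mul_integral_comp_mul_left (a := (0 : ℝ)) (b := 1) (c := x)
    (f := fun y => (y * (2 - y)) ^ ((m : ℝ) / 2) * (-(2 * ((m : ℝ) + 1)) * h y))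
  rw [mul_zero, mul_one] at hs
  rw [← hs, ← intervalIntegral.integral_const_mul, ← intervalIntegral.integral_const_mul]
  refine intervalIntegral.integral_congr fun u hu => ?_
  rw [Set.uIcc_of_le zero_le_one] at hu
  have h2 : 0 < 2 - x := by linarith
  have hn : 0 ≤ 2 - x * u := by nlinarith [hu.1, hu.2]
  have e1 : (x * (2 - x)) ^ ((m : ℝ) / 2) * (u ^ ((m : ℝ) / 2) *
      ((2 - x * u) / (2 - x)) ^ ((m : ℝ) / 2)) = (x * u * (2 - x * u)) ^ ((m : ℝ) / 2) := by
    rw [← Real.mul_rpow hu.1 (by positivity), ← Real.mul_rpow (by positivity)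
      (mul_nonneg hu.1 (by positivity))]
    congr 1
    field_simp
  simp only [poleKernel]
  rw [← e1]
  field_simp

/-- `v` is the regular solution with value `a` at the pole, in integrated form with the truncated
nonlinearity, and `v₁` is its derivative. -/
structure IsPoleSolution (m : ℕ) (a : ℝ) (v v₁ : ℝ → ℝ) : Prop where
  continuous : Continuous v
  continuous_deriv : Continuous v₁
  hasDerivAt : ∀ x, HasDerivAt v (v₁ x) x
  apply_zero : v 0 = a
  deriv_eq : ∀ x, v₁ x =
    ∫ u in (0 : ℝ)..1, poleKernel m (clampPole x) u * truncExp a (v (x * u))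

theorem exists_bound_poleKernel (m : ℕ) :
    ∃ M, 0 < M ∧ ∀ y, ∀ u ∈ Set.Icc (0 : ℝ) 1, |poleKernel m (clampPole y) u| ≤ M := by
  obtain ⟨B, hB⟩ := (isCompact_Icc.prod isCompact_Icc : IsCompact
    (Set.Icc (-1 : ℝ) (3 / 2) ×ˢ Set.Icc (0 : ℝ) 1)).exists_bound_of_continuousOn
    (continuous_poleKernel_clamp m).continuousOn
  refine ⟨max B 1, by positivity, fun y u hu => le_max_of_le_left ?_⟩
  have := hB (clampPole y, u) ⟨clampPole_mem y, hu⟩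
  simpa [clampPole_of_mem (clampPole_mem y)] using this

theorem continuous_truncExp_right (a : ℝ) : Continuous (truncExp a) :=
  continuous_truncExp.comp (by fun_prop : Continuous fun x => (a, x))

theorem exists_pole_integral_eq (m : ℕ) : ∃ V : ℝ → ℝ → ℝ, Continuous (Function.uncurry V) ∧
    ∀ a x, V a x = a + ∫ y in (0 : ℝ)..x, ∫ u in (0 : ℝ)..1,
      poleKernel m (clampPole y) u * truncExp a (V a (y * u)) := by
  obtain ⟨M, hM, hKM⟩ := exists_bound_poleKernel m
  have hL : ∀ a s t, |truncExp a s - truncExp a t| ≤ (Real.exp a + 1) * |s - t| := fun a s t =>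
    (abs_truncExp_sub_le a s t).trans
      (mul_le_mul_of_nonneg_right (by linarith) (abs_nonneg _))
  have h0 : ∀ a, |truncExp a a| ≤ Real.exp a + 1 := fun a => by
    rw [truncExp_of_le le_rfl, abs_le]
    constructor <;> linarith [Real.exp_pos a]
  exact exists_continuous_family_integral_eq (fun y u => poleKernel m (clampPole y) u) truncExp
    (fun a => Real.exp a + 1) M hM (continuous_poleKernel_clamp m) hKM (by fun_prop)
    (fun a => by positivity) continuous_truncExp hL h0

theorem continuous_poleKernel_mul_truncExp (m : ℕ) {V : ℝ → ℝ → ℝ}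
    (hV : Continuous (Function.uncurry V)) :
    Continuous (Function.uncurry fun (p : ℝ × ℝ) (u : ℝ) =>
      poleKernel m (clampPole p.2) u * truncExp p.1 (V p.1 (p.2 * u))) := by
  have h1 : Continuous fun q : (ℝ × ℝ) × ℝ => poleKernel m (clampPole q.1.2) q.2 :=
    (continuous_poleKernel_clamp m).comp (by fun_prop : Continuous fun q : (ℝ × ℝ) × ℝ =>
      (q.1.2, q.2))
  have h2 : Continuous fun q : (ℝ × ℝ) × ℝ => V q.1.1 (q.1.2 * q.2) :=
    hV.comp (by fun_prop : Continuous fun q : (ℝ × ℝ) × ℝ => (q.1.1, q.1.2 * q.2))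
  exact h1.mul (continuous_truncExp.comp
    ((by fun_prop : Continuous fun q : (ℝ × ℝ) × ℝ => q.1.1).prodMk h2))

theorem exists_poleSolution_family (m : ℕ) : ∃ V V₁ : ℝ → ℝ → ℝ,
    Continuous (Function.uncurry V) ∧ Continuous (Function.uncurry V₁) ∧
      ∀ a, IsPoleSolution m a (V a) (V₁ a) := by
  obtain ⟨V, hV, hVeq⟩ := exists_pole_integral_eq m
  obtain ⟨V₁, hV₁def⟩ : ∃ V₁ : ℝ → ℝ → ℝ, ∀ a y, V₁ a y =
    ∫ u in (0 : ℝ)..1, poleKernel m (clampPole y) u * truncExp a (V a (y * u)) :=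
    ⟨_, fun _ _ => rfl⟩
  have hV₁ : Continuous (Function.uncurry V₁) := by
    refine (intervalIntegral.continuous_parametric_intervalIntegral_of_continuous'
      (μ := MeasureTheory.volume) (continuous_poleKernel_mul_truncExp m hV) 0 1).congr fun p => ?_
    exact (hV₁def p.1 p.2).symm
  have hVa : ∀ a, Continuous (V a) := fun a => hV.comp (by fun_prop : Continuous fun x => (a, x))
  have hV₁a : ∀ a, Continuous (V₁ a) := fun a =>
    hV₁.comp (by fun_prop : Continuous fun x => (a, x))
  refine ⟨V, V₁, hV, hV₁, fun a => ⟨hVa a, hV₁a a, fun x => ?_, ?_, hV₁def a⟩⟩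
  swap
  · rw [hVeq, intervalIntegral.integral_same, add_zero]
  have : V a = fun x => a + ∫ y in (0 : ℝ)..x, V₁ a y := by
    funext x
    simp only [hV₁def]
    exact hVeq a x
  rw [this]
  exact (intervalIntegral.integral_hasDerivAt_right ((hV₁a a).intervalIntegrable _ _)
    ((hV₁a a).stronglyMeasurableAtFilter _ _) (hV₁a a).continuousAt).const_add _

section PoleSolution

variable {m : ℕ} {a : ℝ} {v v₁ : ℝ → ℝ}

/-- Differentiation under the integral sign in the formula for `v₁`. The interval contains `0` in
its interior, so smoothness at the pole is included. -/
theorem IsPoleSolution.exists_deriv_deriv (hv : IsPoleSolution m a v v₁) :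
    ∃ v₂ : ℝ → ℝ, Continuous v₂ ∧
      ∀ x ∈ Set.Ioo (-1 : ℝ) (3 / 2), HasDerivAt v₁ (v₂ x) x := by
  have hK := continuous_poleKernel_clamp m
  let c1 : ℝ → ℝ := fun u => max 0 (min u 1)
  have hc1u : ∀ {u : ℝ}, u ∈ Set.Icc (0 : ℝ) 1 → c1 u = u := fun hu => by
    simp only [c1]; rw [min_eq_left hu.2, max_eq_right hu.1]
  let F' : ℝ → ℝ → ℝ := fun x u =>
    poleKernelDeriv m (clampPole x) (c1 u) * truncExp a (v (x * u))
      + poleKernel m (clampPole x) u * (Real.exp (min (v (x * u)) a) * (v₁ (x * u) * u))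
  have hVxu : Continuous fun p : ℝ × ℝ => v (p.1 * p.2) := (hv.continuous).comp (by fun_prop)
  have hV₁xu : Continuous fun p : ℝ × ℝ => v₁ (p.1 * p.2) := (hv.continuous_deriv).comp (by fun_prop)
  have hF'c : Continuous (Function.uncurry F') := by
    have h1 := continuous_poleKernelDeriv_clamp m
    simp only [Function.uncurry_def] at h1 hK
    simp only [F', Function.uncurry_def]
    exact (h1.mul ((continuous_truncExp_right a).comp hVxu)).add
      (hK.mul ((Real.continuous_exp.comp (hVxu.min continuous_const)).mul
        (hV₁xu.mul continuous_snd)))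
  have hd2 : ∀ x ∈ Set.Ioo (-1 : ℝ) (3 / 2),
      HasDerivAt v₁ (∫ u in (0 : ℝ)..1, F' x u) x := by
    intro x hx
    rw [show v₁ = _ from funext hv.deriv_eq]
    refine hasDerivAt_integral_of_continuous_deriv
      (F := fun x u => poleKernel m (clampPole x) u * truncExp a (v (x * u)))
      (hK.mul ((continuous_truncExp_right a).comp hVxu)) hF'c ?_ hx
    intro y hy u hu
    have h1 : HasDerivAt (fun x => poleKernel m (clampPole x) u) (poleKernelDeriv m (clampPole y) (c1 u)) y := by
      rw [clampPole_of_mem (Set.Ioo_subset_Icc_self hy), hc1u hu]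
      refine (hasDerivAt_poleKernel m (by linarith [hy.2]) hu).congr_of_eventuallyEq ?_
      filter_upwards [isOpen_Ioo.mem_nhds hy] with z hz
      simp only [clampPole_of_mem (Set.Ioo_subset_Icc_self hz)]
    have h2 : HasDerivAt (fun x => v (x * u)) (v₁ (y * u) * u) y := by
      have := (hv.hasDerivAt (y * u)).comp y ((hasDerivAt_id y).mul_const u)
      rw [one_mul] at this
      exact this
    exact h1.mul (HasDerivAt.comp (h₂ := truncExp a) y (hasDerivAt_truncExp a (v (y * u))) h2)
  have hV₂c : Continuous fun x => ∫ u in (0 : ℝ)..1, F' x u :=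
    intervalIntegral.continuous_parametric_intervalIntegral_of_continuous' hF'c 0 1
  exact ⟨_, hV₂c, hd2⟩

/-- Differentiate both sides of the divergence form and cancel the weight, which is positive away
from the pole. -/
theorem IsPoleSolution.ode_of_pos (hv : IsPoleSolution m a v v₁) {v₂ : ℝ → ℝ}
    (hd2 : ∀ x ∈ Set.Ioo (-1 : ℝ) (3 / 2), HasDerivAt v₁ (v₂ x) x)
    {x : ℝ} (hx : x ∈ Set.Ioo (0 : ℝ) (3 / 2)) : x * (2 - x) * v₂ x
      + ((m : ℝ) + 2) * (1 - x) * v₁ x + 2 * ((m : ℝ) + 1) * truncExp a (v x) = 0 := by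
  have hq : 0 < x * (2 - x) := mul_pos hx.1 (by linarith [hx.2])
  have hqd : HasDerivAt (fun x : ℝ => x * (2 - x)) (2 * (1 - x)) x := by
    refine ((hasDerivAt_id x).mul ((hasDerivAt_id x).const_sub 2)).congr_deriv ?_
    simp only [id]; ring
  have hpd := hqd.rpow_const (p := (m : ℝ) / 2) (Or.inl hq.ne')
  have hl := (hpd.mul hqd).mul (hd2 x ⟨by linarith [hx.1], hx.2⟩)
  have hcont : Continuous fun y : ℝ =>
      (y * (2 - y)) ^ ((m : ℝ) / 2) * (-(2 * ((m : ℝ) + 1)) * truncExp a (v y)) :=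
    (Continuous.rpow_const (by fun_prop) fun _ => Or.inr (by positivity)).mul
      (continuous_const.mul ((continuous_truncExp_right a).comp (hv.continuous)))
  have hr := intervalIntegral.integral_hasDerivAt_right (hcont.intervalIntegrable 0 x)
    (hcont.stronglyMeasurableAtFilter _ _) hcont.continuousAt
  have hr' := hr.congr_of_eventuallyEq (f₁ := fun x : ℝ =>
    (x * (2 - x)) ^ ((m : ℝ) / 2) * (x * (2 - x)) * v₁ x) (by
      filter_upwards [isOpen_Ioo.mem_nhds hx] with z hz
      rw [← integral_poleKernel m hz.1 (by linarith [hz.2]) (fun y => truncExp a (v y))]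
      simp only [hv.deriv_eq,
        clampPole_of_mem (⟨by linarith [hz.1], hz.2.le⟩ : z ∈ Set.Icc (-1 : ℝ) (3 / 2))])
  have heq := hl.unique hr'
  have hW : 0 < (x * (2 - x)) ^ ((m : ℝ) / 2) := Real.rpow_pos_of_pos hq _
  have hW1 : (x * (2 - x)) ^ ((m : ℝ) / 2 - 1) * (x * (2 - x)) = (x * (2 - x)) ^ ((m : ℝ) / 2) := by
    rw [Real.rpow_sub_one hq.ne', div_mul_cancel₀ _ hq.ne']
  refine mul_left_cancel₀ hW.ne' ?_
  simp only [Pi.mul_apply] at heq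
  linear_combination heq - ((m : ℝ) * (1 - x) * v₁ x) * hW1

/-- At `x = 0` the weight vanishes and cannot be cancelled; there the equation is the limit from the
right. -/
theorem IsPoleSolution.ode (hv : IsPoleSolution m a v v₁) {v₂ : ℝ → ℝ} (hv₂ : Continuous v₂)
    (hd2 : ∀ x ∈ Set.Ioo (-1 : ℝ) (3 / 2), HasDerivAt v₁ (v₂ x) x)
    {x : ℝ} (hx : x ∈ Set.Icc (0 : ℝ) 1) : x * (2 - x) * v₂ x
      + ((m : ℝ) + 2) * (1 - x) * v₁ x + 2 * ((m : ℝ) + 1) * truncExp a (v x) = 0 := by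
  rcases hx.1.eq_or_lt with h | h
  · have hc : Continuous fun x => x * (2 - x) * v₂ x
        + ((m : ℝ) + 2) * (1 - x) * v₁ x + 2 * ((m : ℝ) + 1) * truncExp a (v x) := by
      have := (continuous_truncExp_right a).comp (hv.continuous)
      have := hv.continuous_deriv
      fun_prop
    subst h
    refine tendsto_nhds_unique (hc.continuousAt.tendsto.mono_left
      (nhdsWithin_le_nhds : nhdsWithin (0 : ℝ) (Set.Ioi 0) ≤ nhds 0)) ?_
    refine tendsto_const_nhds.congr' ?_
    filter_upwards [Ioo_mem_nhdsGT (by norm_num : (0 : ℝ) < 3 / 2)] with z hz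
    exact (hv.ode_of_pos hd2 hz).symm
  · exact hv.ode_of_pos hd2 ⟨h, by linarith [hx.2]⟩

/-- The energy `x(2-x) v₁² / 2 + 2(m+1) ∫_a^v g`, with `g` the truncated nonlinearity, vanishes at
the pole and decreases, whereas `v x > a` would make it positive. Hence the truncation is never
active on `[0, 1]` and the solution satisfies the original equation. -/
theorem IsPoleSolution.le (hv : IsPoleSolution m a v v₁) (ha : 0 < a)
    {x : ℝ} (hx : x ∈ Set.Icc (0 : ℝ) 1) : v x ≤ a := by
  obtain ⟨v₂, hv₂, hd2⟩ := hv.exists_deriv_deriv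
  have hGd : ∀ s, HasDerivAt (fun s => ∫ r in a..s, truncExp a r) (truncExp a s) s := fun s =>
    intervalIntegral.integral_hasDerivAt_right ((continuous_truncExp_right a).intervalIntegrable _ _)
      ((continuous_truncExp_right a).stronglyMeasurableAtFilter _ _) (continuous_truncExp_right a).continuousAt
  set e : ℝ → ℝ := fun x => x * (2 - x) * (v₁ x) ^ 2 / 2
    + 2 * ((m : ℝ) + 1) * ∫ r in a..v x, truncExp a r with he
  have hed : ∀ x ∈ Set.Icc (0 : ℝ) 1,
      HasDerivAt e (-(((m : ℝ) + 1) * (1 - x) * v₁ x ^ 2)) x := by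
    intro x hx
    have hqd : HasDerivAt (fun x : ℝ => x * (2 - x)) (2 * (1 - x)) x := by
      refine ((hasDerivAt_id x).mul ((hasDerivAt_id x).const_sub 2)).congr_deriv ?_
      simp only [id]; ring
    have h1 := ((hqd.mul ((hd2 x ⟨by linarith [hx.1], by linarith [hx.2]⟩).pow 2)).div_const 2).add
      (((hGd (v x)).comp x (hv.hasDerivAt x)).const_mul (2 * ((m : ℝ) + 1)))
    refine h1.congr_deriv ?_
    simp only [Pi.pow_apply]
    push_cast
    linear_combination (v₁ x) * hv.ode hv₂ hd2 hx
  have hanti : AntitoneOn e (Set.Icc 0 1) := by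
    refine antitoneOn_of_deriv_nonpos (convex_Icc 0 1)
      (fun x hx => (hed x hx).continuousAt.continuousWithinAt)
      (fun x hx => (hed x (interior_subset hx)).differentiableAt.differentiableWithinAt) ?_
    intro x hx
    have hx' := interior_subset hx
    rw [(hed x hx').deriv, neg_nonpos]
    have : 0 ≤ 1 - x := by linarith [hx'.2]
    positivity
  have hex : e x ≤ 0 := by
    have := hanti (Set.left_mem_Icc.2 zero_le_one) hx hx.1
    simpa [he, hv.apply_zero] using this
  by_contra hcon
  push Not at hcon
  have hpos : 0 < ∫ r in a..v x, truncExp a r :=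
    intervalIntegral.intervalIntegral_pos_of_pos_on ((continuous_truncExp_right a).intervalIntegrable _ _)
      (fun r hr => truncExp_pos ha hr.1.le) hcon
  have h2 : 0 ≤ x * (2 - x) * (v₁ x) ^ 2 / 2 := by
    have : 0 ≤ 2 - x := by linarith [hx.2]
    have := hx.1
    positivity
  have h3 : 0 < 2 * ((m : ℝ) + 1) * ∫ r in a..v x, truncExp a r := by positivity
  simp only [he] at hex
  linarith

theorem IsPoleSolution.abs_deriv_le (hv : IsPoleSolution m a v v₁) (ha : 0 < a) {M : ℝ}
    (hKM : ∀ y, ∀ u ∈ Set.Icc (0 : ℝ) 1, |poleKernel m (clampPole y) u| ≤ M)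
    {x : ℝ} (hx : x ∈ Set.Icc (0 : ℝ) 1) : |v₁ x| ≤ M * Real.exp a := by
  have hM : 0 ≤ M := (abs_nonneg _).trans (hKM 0 0 (by simp))
  have := intervalIntegral.norm_integral_le_of_norm_le_const (a := (0 : ℝ)) (b := 1)
    (f := fun u => poleKernel m (clampPole x) u * truncExp a (v (x * u))) (C := M * Real.exp a) (by
      intro u hu
      rw [Set.uIoc_of_le zero_le_one] at hu
      have hxu : x * u ∈ Set.Icc (0 : ℝ) 1 :=
        ⟨mul_nonneg hx.1 hu.1.le, mul_le_one₀ hx.2 hu.1.le hu.2⟩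
      rw [Real.norm_eq_abs, abs_mul]
      refine mul_le_mul (hKM x u ⟨hu.1.le, hu.2⟩) ?_ (abs_nonneg _) hM
      rw [truncExp_of_le (hv.le ha hxu), abs_le]
      have h1 := Real.exp_le_exp.2 (hv.le ha hxu)
      have h2 := Real.exp_pos (v (x * u))
      have h3 := Real.one_le_exp ha.le
      constructor <;> linarith)
  rw [hv.deriv_eq]
  simpa using this

end PoleSolution

/-- The regular solutions at the pole, for the equation in the variable `x = 1 - cos θ`. -/
theorem exists_regular_family (m : ℕ) :
    ∃ (C : ℝ) (V V₁ : ℝ → ℝ → ℝ), 0 ≤ C ∧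
      Continuous (Function.uncurry V) ∧ Continuous (Function.uncurry V₁) ∧ (∀ a, V a 0 = a) ∧
      ∀ a, 0 < a → ∃ V₂ : ℝ → ℝ, Continuous V₂ ∧
        (∀ x ∈ Set.Ioo (-1 : ℝ) (3 / 2), HasDerivAt (V a) (V₁ a x) x ∧
          HasDerivAt (V₁ a) (V₂ x) x) ∧
        (∀ x ∈ Set.Icc (0 : ℝ) 1, x * (2 - x) * V₂ x + ((m : ℝ) + 2) * (1 - x) * V₁ a x
          + 2 * ((m : ℝ) + 1) * (Real.exp (V a x) - 1) = 0) ∧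
        ∀ x ∈ Set.Icc (0 : ℝ) 1, V a x ≤ a ∧ |V₁ a x| ≤ C * Real.exp a := by
  obtain ⟨M, hM, hKM⟩ := exists_bound_poleKernel m
  obtain ⟨V, V₁, hV, hV₁, h⟩ := exists_poleSolution_family m
  refine ⟨M, V, V₁, hM.le, hV, hV₁, fun a => (h a).apply_zero, fun a ha => ?_⟩
  obtain ⟨V₂, hV₂, hd2⟩ := (h a).exists_deriv_deriv
  refine ⟨V₂, hV₂, fun x hx => ⟨(h a).hasDerivAt x, hd2 x hx⟩, fun x hx => ?_,
    fun x hx => ⟨(h a).le ha hx, (h a).abs_deriv_le ha hKM hx⟩⟩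
  rw [← truncExp_of_le ((h a).le ha hx)]
  exact (h a).ode hV₂ hd2 hx

/-! ### The phase plane: energy and polar angle -/

/-- Apply `log t ≤ t - 1` at `t = √(1 + A)`. This makes the energy coercive. -/
theorem sq_sqrt_sub_one_le {A : ℝ} (hA : -1 < A) :
    (√(1 + A) - 1) ^ 2 ≤ A - Real.log (1 + A) := by
  have h0 : 0 < 1 + A := by linarith
  have h1 : Real.log (1 + A) = 2 * Real.log √(1 + A) := by
    rw [Real.log_sqrt h0.le]; ring
  have h2 := Real.log_le_sub_one_of_pos (Real.sqrt_pos.2 h0)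
  have h3 := Real.sq_sqrt h0.le
  nlinarith

theorem sub_log_le_sq_div {A : ℝ} (hA : -1 < A) : A - Real.log (1 + A) ≤ A ^ 2 / (1 + A) := by
  have h0 : 0 < 1 + A := by linarith
  have h1 := Real.one_sub_inv_le_log_of_pos h0
  have h2 : A ^ 2 / (1 + A) = A - (1 - (1 + A)⁻¹) := by field_simp; ring
  linarith

/-- The curve `(A, P)` is a solution of the phase plane system on `[0, 1]` issuing from `(-1, 2)`;
`A'` and `P'` are the derivatives. -/
structure IsPhaseCurve (m : ℝ) (A P A' P' : ℝ → ℝ) : Prop where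
  hasDerivAt_fst : ∀ x ∈ Set.Icc (0 : ℝ) 1, HasDerivAt A (A' x) x
  hasDerivAt_snd : ∀ x ∈ Set.Icc (0 : ℝ) 1, HasDerivAt P (P' x) x
  continuousOn_deriv_fst : ContinuousOn A' (Set.Icc 0 1)
  continuousOn_deriv_snd : ContinuousOn P' (Set.Icc 0 1)
  eq_fst : ∀ x ∈ Set.Icc (0 : ℝ) 1, x * (2 - x) * A' x = (1 + A x) * P x
  eq_snd : ∀ x ∈ Set.Icc (0 : ℝ) 1, x * (2 - x) * P' x = -m * (1 - x) * P x - 2 * m * A x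
  fst_zero : A 0 = -1
  snd_zero : P 0 = 2
  lt_fst : ∀ x ∈ Set.Ioc (0 : ℝ) 1, -1 < A x

/-- Energy of the phase plane system. -/
noncomputable def phaseEnergy (m : ℝ) (A P : ℝ → ℝ) (x : ℝ) : ℝ :=
  P x ^ 2 / 2 + 2 * m * (A x - Real.log (1 + A x))

/-- Angular velocity of the curve `(A, P)`, extended from `[0, 1]` by constants. -/
noncomputable def angleRate (A P A' P' : ℝ → ℝ) (x : ℝ) : ℝ :=
  (A (max 0 (min x 1)) * P' (max 0 (min x 1)) - P (max 0 (min x 1)) * A' (max 0 (min x 1))) /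
    (A (max 0 (min x 1)) ^ 2 + P (max 0 (min x 1)) ^ 2)

/-- Continuous angle of the curve `(A, P)` issuing from `(-1, 2)`. -/
noncomputable def phaseAngle (A P A' P' : ℝ → ℝ) (x : ℝ) : ℝ :=
  Real.pi - Real.arctan 2 + ∫ y in (0 : ℝ)..x, angleRate A P A' P' y

theorem clamp_mem (x : ℝ) : max 0 (min x 1) ∈ Set.Icc (0 : ℝ) 1 :=
  ⟨le_max_left _ _, max_le zero_le_one (min_le_right _ _)⟩

theorem clamp_of_mem {x : ℝ} (hx : x ∈ Set.Icc (0 : ℝ) 1) : max 0 (min x 1) = x := by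
  rw [min_eq_left hx.2, max_eq_right hx.1]

namespace IsPhaseCurve

variable {m : ℝ} {A P A' P' : ℝ → ℝ}

theorem mul_pos_of_mem {x : ℝ} (hx : x ∈ Set.Ioc (0 : ℝ) 1) : 0 < x * (2 - x) :=
  mul_pos hx.1 (by linarith [hx.2])

theorem hasDerivAt_energy (h : IsPhaseCurve m A P A' P') {x : ℝ} (hx : x ∈ Set.Ioc (0 : ℝ) 1) :
    HasDerivAt (phaseEnergy m A P) (-m * (1 - x) * P x ^ 2 / (x * (2 - x))) x := by
  have hx' : x ∈ Set.Icc (0 : ℝ) 1 := Set.Ioc_subset_Icc_self hx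
  have hq := mul_pos_of_mem hx
  have hA : 0 < 1 + A x := by linarith [h.lt_fst x hx]
  have h1 := (((h.hasDerivAt_snd x hx').pow 2).div_const 2).add
    (((h.hasDerivAt_fst x hx').sub (((h.hasDerivAt_fst x hx').const_add 1).log hA.ne')).const_mul
      (2 * m))
  refine h1.congr_deriv ?_
  rw [eq_div_iff hq.ne']
  have e1 : A' x * (x * (2 - x)) / (1 + A x) = P x := by
    rw [div_eq_iff hA.ne']; linarith [h.eq_fst x hx']
  push_cast
  linear_combination P x * h.eq_snd x hx' + 2 * m * h.eq_fst x hx' - 2 * m * e1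

theorem antitoneOn_energy (h : IsPhaseCurve m A P A' P') (hm : 0 ≤ m) :
    AntitoneOn (phaseEnergy m A P) (Set.Ioc 0 1) := by
  refine antitoneOn_of_deriv_nonpos (convex_Ioc 0 1)
    (fun x hx => (h.hasDerivAt_energy hx).continuousAt.continuousWithinAt)
    (fun x hx => (h.hasDerivAt_energy (interior_subset hx)).differentiableAt.differentiableWithinAt)
    fun x hx => ?_
  have hx' := interior_subset hx
  rw [(h.hasDerivAt_energy hx').deriv]
  have := mul_pos_of_mem hx'
  have h1 : 0 ≤ m * (1 - x) * P x ^ 2 :=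
    mul_nonneg (mul_nonneg hm (by linarith [hx'.2])) (sq_nonneg _)
  exact div_nonpos_of_nonpos_of_nonneg (by linarith) this.le

theorem le_energy (h : IsPhaseCurve m A P A' P') (hm : 0 ≤ m) {x : ℝ}
    (hx : x ∈ Set.Ioc (0 : ℝ) 1) :
    P x ^ 2 / 2 + 2 * m * (√(1 + A x) - 1) ^ 2 ≤ phaseEnergy m A P x := by
  have := mul_le_mul_of_nonneg_left (sq_sqrt_sub_one_le (h.lt_fst x hx)) (mul_nonneg zero_le_two hm)
  rw [phaseEnergy]; linarith

/-- Backward uniqueness through the energy: it cannot decay fast enough to reach zero. If it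
vanished at `x`, it would vanish on all of `(0, x]`, forcing `A = 0` there against `A 0 = -1`. -/
theorem ne_zero (h : IsPhaseCurve m A P A' P') (hm : 1 ≤ m) {x : ℝ}
    (hx : x ∈ Set.Icc (0 : ℝ) 1) : A x ^ 2 + P x ^ 2 ≠ 0 := by
  intro h0
  have hA0 : A x = 0 := by nlinarith [sq_nonneg (A x), sq_nonneg (P x)]
  have hP0 : P x = 0 := by nlinarith [sq_nonneg (A x), sq_nonneg (P x)]
  have hx0 : 0 < x := by
    rcases hx.1.eq_or_lt with h1 | h1
    · rw [← h1, h.fst_zero] at hA0; norm_num at hA0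
    · exact h1
  -- The factor is `(y / (2 - y)) ^ m`, with logarithmic derivative `2m / (y(2-y))`. It outweighs
  -- the dissipation `m(1-y)P²`, which is at most `2m` times the energy, so `w` increases.
  set w : ℝ → ℝ := fun y => phaseEnergy m A P y * Real.exp (m * (Real.log y - Real.log (2 - y)))
    with hw
  have hwd : ∀ y ∈ Set.Ioc (0 : ℝ) 1, HasDerivAt w
      ((2 * m * phaseEnergy m A P y - m * (1 - y) * P y ^ 2) / (y * (2 - y)) *
        Real.exp (m * (Real.log y - Real.log (2 - y)))) y := by
    intro y hy
    have hy0 : 0 < y := hy.1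
    have hy2 : 0 < 2 - y := by linarith [hy.2]
    have h1 : HasDerivAt (fun y : ℝ => 2 - y) (-1) y := by
      simpa using (hasDerivAt_id y).const_sub 2
    have h2 := (((Real.hasDerivAt_log hy0.ne').sub (h1.log hy2.ne')).const_mul m).exp
    refine ((h.hasDerivAt_energy hy).mul h2).congr_deriv ?_
    simp only [Pi.sub_apply]
    field_simp
    ring
  have hmono : MonotoneOn w (Set.Ioc 0 1) := by
    refine monotoneOn_of_deriv_nonneg (convex_Ioc 0 1)
      (fun x hx => (hwd x hx).continuousAt.continuousWithinAt)
      (fun x hx => (hwd x (interior_subset hx)).differentiableAt.differentiableWithinAt)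
      fun y hy => ?_
    have hy' := interior_subset hy
    rw [(hwd y hy').deriv]
    have h1 := h.le_energy (by linarith) hy'
    have h2 := mul_pos_of_mem hy'
    have h3 : 0 ≤ 2 * m * phaseEnergy m A P y - m * (1 - y) * P y ^ 2 := by
      have h4 : P y ^ 2 / 2 ≤ phaseEnergy m A P y := by
        have : 0 ≤ 2 * m * (√(1 + A y) - 1) ^ 2 := by positivity
        linarith
      have h5 : 0 ≤ m * y * P y ^ 2 := by
        have := hy'.1.le
        positivity
      nlinarith
    positivity
  have hzero : ∀ y ∈ Set.Ioc (0 : ℝ) x, A y = 0 := by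
    intro y hy
    have hy' : y ∈ Set.Ioc (0 : ℝ) 1 := ⟨hy.1, hy.2.trans hx.2⟩
    have h1 := hmono hy' ⟨hx0, hx.2⟩ hy.2
    have h2 : w x = 0 := by simp [hw, phaseEnergy, hA0, hP0]
    have h3 : phaseEnergy m A P y ≤ 0 := by
      rw [h2] at h1
      exact nonpos_of_mul_nonpos_left h1 (Real.exp_pos _)
    have h4 := h.le_energy (by linarith) hy'
    have h5 : (√(1 + A y) - 1) ^ 2 = 0 := by nlinarith [sq_nonneg (P y), sq_nonneg (√(1 + A y) - 1)]
    have h6 : √(1 + A y) = 1 := by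
      have := pow_eq_zero_iff (two_ne_zero) |>.1 h5
      linarith
    have h7 := Real.sq_sqrt (show 0 ≤ 1 + A y by linarith [h.lt_fst y hy'])
    rw [h6] at h7; linarith
  have hc : ContinuousAt A 0 := (h.hasDerivAt_fst 0 (by simp)).continuousAt
  have ht := hc.tendsto.mono_left (nhdsWithin_le_nhds : nhdsWithin (0 : ℝ) (Set.Ioi 0) ≤ nhds 0)
  have ht' : Filter.Tendsto A (nhdsWithin (0 : ℝ) (Set.Ioi 0)) (nhds 0) := by
    refine tendsto_const_nhds.congr' ?_
    filter_upwards [Ioo_mem_nhdsGT hx0] with z hz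
    exact (hzero z ⟨hz.1, hz.2.le⟩).symm
  have := tendsto_nhds_unique ht ht'
  rw [h.fst_zero] at this
  norm_num at this

theorem continuousOn_fst (h : IsPhaseCurve m A P A' P') : ContinuousOn A (Set.Icc 0 1) :=
  fun x hx => (h.hasDerivAt_fst x hx).continuousAt.continuousWithinAt

theorem continuousOn_snd (h : IsPhaseCurve m A P A' P') : ContinuousOn P (Set.Icc 0 1) :=
  fun x hx => (h.hasDerivAt_snd x hx).continuousAt.continuousWithinAt

theorem continuous_clamp {f : ℝ → ℝ} (hf : ContinuousOn f (Set.Icc 0 1)) :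
    Continuous fun x => f (max 0 (min x 1)) :=
  hf.comp_continuous (by fun_prop) clamp_mem

theorem continuous_angleRate (h : IsPhaseCurve m A P A' P') (hm : 1 ≤ m) :
    Continuous (angleRate A P A' P') := by
  have h1 := continuous_clamp h.continuousOn_fst
  have h2 := continuous_clamp h.continuousOn_snd
  have h3 := continuous_clamp h.continuousOn_deriv_fst
  have h4 := continuous_clamp h.continuousOn_deriv_snd
  exact Continuous.div ((h1.mul h4).sub (h2.mul h3)) ((h1.pow 2).add (h2.pow 2)) fun x => h.ne_zero hm (clamp_mem x)

theorem hasDerivAt_angle (h : IsPhaseCurve m A P A' P') (hm : 1 ≤ m) (x : ℝ) :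
    HasDerivAt (phaseAngle A P A' P') (angleRate A P A' P' x) x := by
  have hc := h.continuous_angleRate hm
  exact (intervalIntegral.integral_hasDerivAt_right (hc.intervalIntegrable _ _)
    (hc.stronglyMeasurableAtFilter _ _) hc.continuousAt).const_add _

theorem phaseAngle_zero : phaseAngle A P A' P' 0 = Real.pi - Real.arctan 2 := by
  simp [phaseAngle]

/-- The integrated angle really is a polar angle: the component of `(A, P)` orthogonal to the
direction of that angle, divided by the radius up to a constant, has zero derivative and vanishes at
the start. -/
theorem snd_mul_cos_eq (h : IsPhaseCurve m A P A' P') (hm : 1 ≤ m) {x : ℝ}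
    (hx : x ∈ Set.Icc (0 : ℝ) 1) :
    P x * Real.cos (phaseAngle A P A' P' x) = A x * Real.sin (phaseAngle A P A' P' x) := by
  -- Logarithmic derivative of the radius.
  set q : ℝ → ℝ := fun x => (A (max 0 (min x 1)) * A' (max 0 (min x 1))
    + P (max 0 (min x 1)) * P' (max 0 (min x 1))) /
    (A (max 0 (min x 1)) ^ 2 + P (max 0 (min x 1)) ^ 2) with hq
  have hqc : Continuous q := by
    have h1 := continuous_clamp h.continuousOn_fst
    have h2 := continuous_clamp h.continuousOn_snd
    have h3 := continuous_clamp h.continuousOn_deriv_fst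
    have h4 := continuous_clamp h.continuousOn_deriv_snd
    exact Continuous.div ((h1.mul h3).add (h2.mul h4)) ((h1.pow 2).add (h2.pow 2)) fun x => h.ne_zero hm (clamp_mem x)
  set t := phaseAngle A P A' P' with ht
  set S : ℝ → ℝ := fun x => (P x * Real.cos (t x) - A x * Real.sin (t x)) *
    Real.exp (-∫ y in (0 : ℝ)..x, q y) with hS
  have hSd : ∀ x ∈ Set.Icc (0 : ℝ) 1, HasDerivAt S 0 x := by
    intro x hx
    have hn := h.ne_zero hm hx
    have h1 := (intervalIntegral.integral_hasDerivAt_right (hqc.intervalIntegrable 0 x)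
      (hqc.stronglyMeasurableAtFilter _ _) hqc.continuousAt).neg.exp
    have h2 := h.hasDerivAt_angle hm x
    have h3 := (((h.hasDerivAt_snd x hx).mul h2.cos).sub
      ((h.hasDerivAt_fst x hx).mul h2.sin)).mul h1
    refine h3.congr_deriv ?_
    simp only [Pi.sub_apply, Pi.mul_apply, hq, angleRate, clamp_of_mem hx, Pi.neg_apply, ← ht]
    field_simp
    ring
  have hconst : S x = S 0 := by
    refine constant_of_has_deriv_right_zero (f := S) (a := 0) (b := 1)
      (fun x hx => (hSd x hx).continuousAt.continuousWithinAt)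
      (fun x hx => (hSd x ⟨hx.1, hx.2.le⟩).hasDerivWithinAt) x hx
  have h0 : S 0 = 0 := by
    have h1 : Real.sin (Real.arctan 2) = 2 * Real.cos (Real.arctan 2) := by
      have := Real.tan_mul_cos (Real.cos_arctan_pos 2).ne'
      rw [Real.tan_arctan] at this
      exact this.symm
    simp only [hS, ht, phaseAngle_zero, h.fst_zero, h.snd_zero, Real.cos_pi_sub, Real.sin_pi_sub,
      h1]
    simp
  rw [h0] at hconst
  have := (mul_eq_zero.1 hconst).resolve_right (Real.exp_pos _).ne'
  linarith

theorem mul_angleRate (h : IsPhaseCurve m A P A' P') (hm : 1 ≤ m) {x : ℝ}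
    (hx : x ∈ Set.Icc (0 : ℝ) 1) :
    x * (2 - x) * angleRate A P A' P' x * (A x ^ 2 + P x ^ 2) =
      -m * (1 - x) * (A x * P x) - 2 * m * A x ^ 2 - (1 + A x) * P x ^ 2 := by
  have hn := h.ne_zero hm hx
  rw [angleRate, clamp_of_mem hx, mul_assoc, div_mul_cancel₀ _ hn]
  linear_combination A x * h.eq_snd x hx - P x * h.eq_fst x hx

/-- The level `π` is a barrier: there `P = 0`, so the angular velocity is strictly negative, and the
initial angle lies below it. -/
theorem angle_le_pi (h : IsPhaseCurve m A P A' P') (hm : 1 ≤ m) {x : ℝ}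
    (hx : x ∈ Set.Icc (0 : ℝ) 1) : phaseAngle A P A' P' x ≤ Real.pi := by
  have hat : 0 < Real.arctan 2 := Real.arctan_pos.2 two_pos
  refine image_le_of_deriv_right_lt_deriv_boundary (f := phaseAngle A P A' P')
    (f' := angleRate A P A' P') (a := 0) (b := 1) (B := fun _ => Real.pi) (B' := fun _ => 0)
    (fun x _ => (h.hasDerivAt_angle hm x).continuousAt.continuousWithinAt)
    (fun x _ => (h.hasDerivAt_angle hm x).hasDerivWithinAt)
    (by rw [phaseAngle_zero]; linarith) (fun x => hasDerivAt_const _ _) ?_ hx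
  intro y hy hyp
  have hy0 : 0 < y := by
    rcases hy.1.eq_or_lt with h1 | h1
    · rw [← h1, phaseAngle_zero] at hyp; linarith
    · exact h1
  have hy' : y ∈ Set.Icc (0 : ℝ) 1 := ⟨hy.1, hy.2.le⟩
  have h1 := h.snd_mul_cos_eq hm hy'
  rw [hyp, Real.cos_pi, Real.sin_pi] at h1
  have hP : P y = 0 := by linarith
  have h2 := h.mul_angleRate hm hy'
  have hn := h.ne_zero hm hy'
  rw [hP] at h2 hn
  have hA : 0 < A y ^ 2 := lt_of_le_of_ne (sq_nonneg _) (by simpa using hn.symm)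
  have hq := mul_pos_of_mem (⟨hy0, hy.2.le⟩ : y ∈ Set.Ioc (0 : ℝ) 1)
  by_contra hcon
  push Not at hcon
  have : 0 ≤ y * (2 - y) * angleRate A P A' P' y * (A y ^ 2 + 0 ^ 2) := by positivity
  nlinarith

/-- The quadratic form `2mα² - mαβ + (15/16)β²` equals `2m(α - β/4)² + (15/16 - m/8)β²`. For `m ≤ 7`
the last coefficient is at least `1/16`, so the form stays definite although `1 + A` may drop to
`15/16`. This is where the upper bound on the dimension enters. -/
theorem angleRate_le (h : IsPhaseCurve m A P A' P') (hm : 1 ≤ m) (hm7 : m ≤ 7) {x : ℝ}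
    (hx : x ∈ Set.Ioc (0 : ℝ) 1) (hA : |A x| ≤ 1 / 16) :
    angleRate A P A' P' x ≤ -(1 / 36 * x⁻¹) := by
  have hx' := Set.Ioc_subset_Icc_self hx
  have hn := h.ne_zero hm hx'
  have hpos : 0 < A x ^ 2 + P x ^ 2 := lt_of_le_of_ne (by positivity) hn.symm
  have h1 := h.mul_angleRate hm hx'
  have hx0 := hx.1
  have hx2 : 0 < 2 - x := by linarith [hx.2]
  have hab : -((1 - x) * (A x * P x)) ≤ |A x| * |P x| := by
    rw [← abs_mul]
    have h2 : |(1 - x) * (A x * P x)| ≤ |A x * P x| := by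
      rw [abs_mul, abs_of_nonneg (by linarith [hx.2] : (0 : ℝ) ≤ 1 - x)]
      exact mul_le_of_le_one_left (abs_nonneg _) (by linarith)
    exact (neg_le_abs _).trans h2
  have hform : -m * (1 - x) * (A x * P x) - 2 * m * A x ^ 2 - (1 + A x) * P x ^ 2
      ≤ -(1 / 18 * (A x ^ 2 + P x ^ 2)) := by
    have h3 : -m * (1 - x) * (A x * P x) ≤ m * (|A x| * |P x|) := by nlinarith
    have h4 : (1 - 1 / 16) * P x ^ 2 ≤ (1 + A x) * P x ^ 2 :=
      mul_le_mul_of_nonneg_right (by linarith [(abs_le.1 hA).1]) (sq_nonneg _)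
    have h5 := sq_abs (A x)
    have h6 := sq_abs (P x)
    have h7 : 0 ≤ (m - 1) * (2 * (|A x| - |P x| / 4) ^ 2) :=
      mul_nonneg (by linarith) (by positivity)
    have h8 : 0 ≤ (7 - m) * |P x| ^ 2 := mul_nonneg (by linarith) (by positivity)
    nlinarith [sq_nonneg (2 * |A x| - |P x| * (9 / 16))]
  rw [← h1] at hform
  have h9 : x * (2 - x) * angleRate A P A' P' x ≤ -(1 / 18) := by
    by_contra hcon
    push Not at hcon
    nlinarith [mul_pos (sub_pos.2 hcon) hpos]
  have h10 : x * angleRate A P A' P' x ≤ -(1 / 36) := by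
    by_contra hcon
    push Not at hcon
    nlinarith [mul_pos (sub_pos.2 hcon) hx2]
  have h11 : angleRate A P A' P' x = x * angleRate A P A' P' x * x⁻¹ := by
    field_simp
  rw [h11]
  have : 0 < x⁻¹ := by positivity
  nlinarith

theorem angle_one_le (h : IsPhaseCurve m A P A' P') (hm : 1 ≤ m) (hm7 : m ≤ 7) {x : ℝ}
    (hx : x ∈ Set.Ioc (0 : ℝ) 1) (hA : ∀ y ∈ Set.Icc x 1, |A y| ≤ 1 / 16) :
    phaseAngle A P A' P' 1 ≤ Real.pi + Real.log x / 36 := by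
  have hd : ∀ y ∈ Set.Icc x 1, HasDerivAt (fun y => phaseAngle A P A' P' y + 1 / 36 * Real.log y)
      (angleRate A P A' P' y + 1 / 36 * y⁻¹) y := fun y hy =>
    (h.hasDerivAt_angle hm y).add ((Real.hasDerivAt_log (hx.1.trans_le hy.1).ne').const_mul _)
  have hanti : AntitoneOn (fun y => phaseAngle A P A' P' y + 1 / 36 * Real.log y)
      (Set.Icc x 1) := by
    refine antitoneOn_of_deriv_nonpos (convex_Icc x 1)
      (fun x hx => (hd x hx).continuousAt.continuousWithinAt)
      (fun x hx => (hd x (interior_subset hx)).differentiableAt.differentiableWithinAt)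
      fun y hy => ?_
    have hy' := interior_subset hy
    rw [(hd y hy').deriv]
    linarith [h.angleRate_le hm hm7 ⟨hx.1.trans_le hy'.1, hy'.2⟩ (hA y hy')]
  have h1 := hanti (Set.left_mem_Icc.2 hx.2) (Set.right_mem_Icc.2 hx.2) hx.2
  have h2 := h.angle_le_pi hm (Set.Ioc_subset_Icc_self hx)
  simp only [Real.log_one] at h1
  linarith

end IsPhaseCurve

/-! ### Attraction to the focus and unbounded rotation -/

namespace IsPhaseCurve

variable {m : ℝ} {A P A' P' : ℝ → ℝ}

theorem bounds_of_energy_le (h : IsPhaseCurve m A P A' P') (hm : 1 ≤ m) {B x : ℝ}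
    (hx : x ∈ Set.Ioc (0 : ℝ) 1) (hB : phaseEnergy m A P x ≤ B) :
    P x ^ 2 ≤ 2 * B ∧ (√(1 + A x) - 1) ^ 2 ≤ B / 2 ∧ 1 + A x ≤ 2 + 2 * B := by
  have h1 := h.le_energy (by linarith) hx
  have h2 : 0 ≤ (m - 1) * (√(1 + A x) - 1) ^ 2 := mul_nonneg (by linarith) (sq_nonneg _)
  have h3 := sq_nonneg (√(1 + A x) - 1)
  have h4 := sq_nonneg (P x)
  have h5 := Real.sq_sqrt (show 0 ≤ 1 + A x by linarith [h.lt_fst x hx])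
  have h6 : (√(1 + A x) - 1) ^ 2 ≤ B / 2 := by nlinarith
  refine ⟨by nlinarith, h6, ?_⟩
  nlinarith [sq_nonneg (√(1 + A x) - 2)]

/-- A curve of bounded energy cannot stay away from the origin for a long logarithmic time, with a
bound uniform over curves. Energy dissipates only through `P`; adding a small multiple of `A * P`
makes the decay see `A` too. The restriction to `x ≤ 1/2` keeps the damping factor `1 - x` bounded
below. -/
theorem exists_sq_add_sq_lt (hm : 1 ≤ m) {B e : ℝ} (hB : 0 ≤ B) (he : 0 < e) :
    ∃ T : ℝ, ∀ A P A' P' : ℝ → ℝ, IsPhaseCurve m A P A' P' → ∀ x₀ x₁ : ℝ, 0 < x₀ → x₀ ≤ x₁ →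
      x₁ ≤ 1 / 2 → phaseEnergy m A P x₀ ≤ B → T < Real.log x₁ - Real.log x₀ →
      ∃ x ∈ Set.Icc x₀ x₁, A x ^ 2 + P x ^ 2 < e := by
  -- Small enough for the `P²` terms produced by the cross term to be absorbed by the dissipation,
  -- given `1 + A ≤ 2 + 2 * B`.
  set d : ℝ := 1 / (4 * (3 + 2 * B + m)) with hd
  have hd0 : 0 < d := by positivity
  have hdm : d * (3 + 2 * B + m) = 1 / 4 := by rw [hd]; field_simp
  have hd1 : d ≤ 1 / 4 := by nlinarith
  refine ⟨(B + (2 + 2 * B) ^ 2) / (d * e / 2), fun A P A' P' h x₀ x₁ h0 h01 h1 hE hT => ?_⟩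
  by_contra hcon
  push Not at hcon
  have hmem : ∀ {x}, x ∈ Set.Icc x₀ x₁ → x ∈ Set.Ioc (0 : ℝ) 1 := fun hx =>
    ⟨h0.trans_le hx.1, hx.2.trans (by linarith)⟩
  have hEx : ∀ x ∈ Set.Icc x₀ x₁, phaseEnergy m A P x ≤ B := fun x hx =>
    (h.antitoneOn_energy (by linarith) (hmem ⟨le_rfl, h01⟩) (hmem hx) hx.1).trans hE
  -- As long as `A² + P² ≥ e`, the modified energy decreases at rate at least `d * e / (2x)`, so `F`
  -- is still antitone; boundedness of its first two terms then limits `log x₁ - log x₀`.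
  set F : ℝ → ℝ := fun x => phaseEnergy m A P x + d * (A x * P x) + d * e / 2 * Real.log x with hF
  have hFd : ∀ x ∈ Set.Icc x₀ x₁, HasDerivAt F (-m * (1 - x) * P x ^ 2 / (x * (2 - x))
      + d * (A' x * P x + A x * P' x) + d * e / 2 * x⁻¹) x := fun x hx =>
    have hx' := Set.Ioc_subset_Icc_self (hmem hx)
    ((h.hasDerivAt_energy (hmem hx)).add
      (((h.hasDerivAt_fst x hx').mul (h.hasDerivAt_snd x hx')).const_mul d)).add
      ((Real.hasDerivAt_log (hmem hx).1.ne').const_mul _)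
  have hanti : AntitoneOn F (Set.Icc x₀ x₁) := by
    refine antitoneOn_of_deriv_nonpos (convex_Icc _ _)
      (fun x hx => (hFd x hx).continuousAt.continuousWithinAt)
      (fun x hx => (hFd x (interior_subset hx)).differentiableAt.differentiableWithinAt)
      fun x hx => ?_
    have hx' := interior_subset hx
    have hxI := hmem hx'
    have hxc := Set.Ioc_subset_Icc_self hxI
    rw [(hFd x hx').deriv]
    have hq := mul_pos_of_mem hxI
    have hx0 := hxI.1
    have hx12 : 1 / 2 ≤ 1 - x := by linarith [hx'.2]
    obtain ⟨b1, -, b2⟩ := h.bounds_of_energy_le hm hxI (hEx x hx')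
    have hform : -m * (1 - x) * P x ^ 2
        + d * ((1 + A x) * P x ^ 2 - m * (1 - x) * (A x * P x) - 2 * m * A x ^ 2) ≤ -(d * e) := by
      have hab : -((1 - x) * (A x * P x)) ≤ A x ^ 2 + P x ^ 2 / 4 := by
        have h3 : 0 ≤ (1 - x) * (A x + P x / 2) ^ 2 := mul_nonneg (by linarith) (sq_nonneg _)
        have h4 : 0 ≤ x * (A x ^ 2 + P x ^ 2 / 4) := by positivity
        nlinarith
      have g1 : d * m * (-((1 - x) * (A x * P x))) ≤ d * m * (A x ^ 2 + P x ^ 2 / 4) :=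
        mul_le_mul_of_nonneg_left hab (by positivity)
      have g2 : d * ((1 + A x) * P x ^ 2) ≤ d * ((2 + 2 * B) * P x ^ 2) := by gcongr
      have g3 : m * (1 / 2) * P x ^ 2 ≤ m * (1 - x) * P x ^ 2 := by gcongr
      have g4 : d * e ≤ d * (A x ^ 2 + P x ^ 2) := by gcongr; exact hcon x hx'
      have g5 : 0 ≤ d * (m - 1) * A x ^ 2 :=
        mul_nonneg (mul_nonneg hd0.le (by linarith)) (sq_nonneg _)
      have g6 : d * (3 + 2 * B + m) * P x ^ 2 = 1 / 4 * P x ^ 2 := by rw [hdm]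
      have g7 : 0 ≤ (m - 1) * P x ^ 2 := mul_nonneg (by linarith) (sq_nonneg _)
      have g8 : 0 ≤ d * m * P x ^ 2 := by positivity
      nlinarith [sq_nonneg (P x)]
    have hsum : (-m * (1 - x) * P x ^ 2 / (x * (2 - x))
      + d * (A' x * P x + A x * P' x)) * (x * (2 - x)) = -m * (1 - x) * P x ^ 2
        + d * ((1 + A x) * P x ^ 2 - m * (1 - x) * (A x * P x) - 2 * m * A x ^ 2) := by
      rw [add_mul, div_mul_cancel₀ _ hq.ne']
      linear_combination d * P x * h.eq_fst x hxc + d * A x * h.eq_snd x hxc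
    rw [← hsum, ← le_div_iff₀ hq] at hform
    have hfin : -(d * e) / (x * (2 - x)) ≤ -(d * e / 2 * x⁻¹) := by
      rw [div_le_iff₀ hq]
      have : d * e / 2 * x⁻¹ * (x * (2 - x)) = d * e / 2 * (2 - x) := by field_simp
      rw [neg_mul, this]
      have : 0 < d * e := by positivity
      nlinarith
    linarith
  have hm0 := Set.left_mem_Icc.2 h01
  have hm1 := Set.right_mem_Icc.2 h01
  have hF01 := hanti hm0 hm1 h01
  have hbd : ∀ x ∈ Set.Icc x₀ x₁, |d * (A x * P x)| ≤ (2 + 2 * B) ^ 2 / 2 := by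
    intro x hx
    obtain ⟨b1, -, b2⟩ := h.bounds_of_energy_le hm (hmem hx) (hEx x hx)
    have b3 := h.lt_fst x (hmem hx)
    have c1 : |A x| ≤ 2 + 2 * B := abs_le.2 ⟨by linarith, by linarith⟩
    have c2 : |P x| ≤ 2 + 2 * B := abs_le_of_sq_le_sq (by nlinarith) (by linarith)
    rw [abs_mul, abs_mul, abs_of_pos hd0]
    have := mul_le_mul c1 c2 (abs_nonneg _) (by positivity)
    have : 0 ≤ |A x| * |P x| := by positivity
    nlinarith
  have hE1 : 0 ≤ phaseEnergy m A P x₁ := by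
    have h3 := h.le_energy (by linarith) (hmem hm1)
    have : 0 ≤ 2 * m * (√(1 + A x₁) - 1) ^ 2 := by positivity
    nlinarith [sq_nonneg (P x₁)]
  have k1 := (abs_le.1 (hbd x₀ hm0)).2
  have k2 := (abs_le.1 (hbd x₁ hm1)).1
  rw [div_lt_iff₀ (by positivity)] at hT
  simp only [hF] at hF01
  nlinarith

/-- If the curve starts with bounded energy sufficiently close to the pole, its total angle at the
equator is arbitrarily negative. -/
theorem exists_angle_one_le (hm : 1 ≤ m) (hm7 : m ≤ 7) {B : ℝ} (hB : 0 ≤ B) (t : ℝ) :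
    ∃ x₁ : ℝ, 0 < x₁ ∧ ∀ A P A' P' : ℝ → ℝ, IsPhaseCurve m A P A' P' → ∀ x₀ : ℝ, 0 < x₀ →
      x₀ < x₁ → phaseEnergy m A P x₀ ≤ B → phaseAngle A P A' P' 1 ≤ t := by
  -- With this radius `|A| ≤ 1/200` and the energy is at most `1/800`. Since energy decreases, `|√(1
  -- + A) - 1| ≤ 1/40` from then on, whence the bound `1/16` needed for the rotation estimate.
  obtain ⟨T, hT⟩ := exists_sq_add_sq_lt hm hB (e := 1 / 40000) (by norm_num)
  set y : ℝ := min (1 / 2) (Real.exp (36 * (t - Real.pi))) with hy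
  have hy0 : 0 < y := by positivity
  refine ⟨y * Real.exp (-|T|), by positivity, fun A P A' P' h x₀ h0 hx hE => ?_⟩
  have hlt : x₀ < y * 1 := hx.trans_le
    (mul_le_mul_of_nonneg_left (Real.exp_le_one_iff.2 (neg_nonpos.2 (abs_nonneg _))) hy0.le)
  rw [mul_one] at hlt
  have hy2 : y ≤ 1 / 2 := min_le_left _ _
  obtain ⟨x, hx1, hx2⟩ := hT A P A' P' h x₀ y h0 hlt.le hy2 hE (by
    have := Real.log_lt_log h0 hx
    rw [Real.log_mul hy0.ne' (Real.exp_pos _).ne', Real.log_exp] at this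
    linarith [le_abs_self T])
  have hxI : x ∈ Set.Ioc (0 : ℝ) 1 := ⟨h0.trans_le hx1.1, hx1.2.trans (by linarith)⟩
  have hAx : |A x| ≤ 1 / 200 := abs_le_of_sq_le_sq (by nlinarith [sq_nonneg (P x)]) (by norm_num)
  have hEx : phaseEnergy m A P x ≤ 1 / 800 := by
    have h1 := sub_log_le_sq_div (h.lt_fst x hxI)
    have h2 : A x ^ 2 / (1 + A x) ≤ 2 * A x ^ 2 := by
      have h3 : 1 / 2 ≤ 1 + A x := by linarith [(abs_le.1 hAx).1]
      rw [div_le_iff₀ (by linarith)]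
      nlinarith [sq_nonneg (A x)]
    have h4 : 2 * m * (A x - Real.log (1 + A x)) ≤ 2 * m * (2 * A x ^ 2) :=
      mul_le_mul_of_nonneg_left (h1.trans h2) (by linarith)
    have h5 : m * A x ^ 2 ≤ 7 * A x ^ 2 := by gcongr
    rw [phaseEnergy]
    nlinarith [sq_nonneg (P x), sq_nonneg (A x)]
  have hAy : ∀ z ∈ Set.Icc x 1, |A z| ≤ 1 / 16 := by
    intro z hz
    have hzI : z ∈ Set.Ioc (0 : ℝ) 1 := ⟨hxI.1.trans_le hz.1, hz.2⟩
    have hEz := (h.antitoneOn_energy (by linarith) hxI hzI hz.1).trans hEx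
    obtain ⟨-, h1, -⟩ := h.bounds_of_energy_le hm hzI hEz
    have h2 := Real.sq_sqrt (show 0 ≤ 1 + A z by linarith [h.lt_fst z hzI])
    have h3 : |√(1 + A z) - 1| ≤ 1 / 40 := abs_le_of_sq_le_sq (by linarith) (by norm_num)
    have h4 := abs_le.1 h3
    rw [abs_le]
    constructor <;> nlinarith
  have h1 := h.angle_one_le hm hm7 hxI hAy
  have h2 := Real.log_le_log hxI.1 (hx1.2.trans (min_le_right _ _))
  rw [Real.log_exp] at h2
  linarith

end IsPhaseCurve

/-! ### Shooting: infinitely many Neumann solutions on the hemisphere -/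

section Family

variable {m : ℕ} {C : ℝ} {V V₁ : ℝ → ℝ → ℝ}

/-- First phase plane coordinate of a function on the sphere, relative to the singular solution
`-2 log sin θ + log (m / (m + 1))`. -/
noncomputable def phaseFst (m : ℕ) (v : ℝ → ℝ) (x : ℝ) : ℝ :=
  ((m : ℝ) + 1) / m * (x * (2 - x)) * Real.exp (v x) - 1

/-- Second phase plane coordinate, in terms of the derivative `v₁`. -/
noncomputable def phaseSnd (v₁ : ℝ → ℝ) (x : ℝ) : ℝ := x * (2 - x) * v₁ x + 2 * (1 - x)

/-- No division by `x(2-x)` occurs here, nor in `phaseSndDeriv`, where the equation eliminates the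
second derivative. The angular velocity is therefore continuous up to the pole and jointly in `a`.
-/
noncomputable def phaseFstDeriv (m : ℕ) (v v₁ : ℝ → ℝ) (x : ℝ) : ℝ :=
  ((m : ℝ) + 1) / m * Real.exp (v x) * phaseSnd v₁ x

noncomputable def phaseSndDeriv (m : ℕ) (v v₁ : ℝ → ℝ) (x : ℝ) : ℝ :=
  -m * (1 - x) * v₁ x - 2 * ((m : ℝ) + 1) * (Real.exp (v x) - 1) - 2

theorem isPhaseCurve_of_ode (hm : 1 ≤ m) {v v₁ v₂ : ℝ → ℝ}
    (hd : ∀ x ∈ Set.Icc (0 : ℝ) 1, HasDerivAt v (v₁ x) x ∧ HasDerivAt v₁ (v₂ x) x)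
    (hode : ∀ x ∈ Set.Icc (0 : ℝ) 1, x * (2 - x) * v₂ x + ((m : ℝ) + 2) * (1 - x) * v₁ x
          + 2 * ((m : ℝ) + 1) * (Real.exp (v x) - 1) = 0) :
    IsPhaseCurve m (phaseFst m v) (phaseSnd v₁) (phaseFstDeriv m v v₁) (phaseSndDeriv m v v₁) := by
  have hm0 : (0 : ℝ) < m := by exact_mod_cast hm
  have hqd : ∀ x, HasDerivAt (fun x : ℝ => x * (2 - x)) (2 * (1 - x)) x := fun x => by
    refine ((hasDerivAt_id x).mul ((hasDerivAt_id x).const_sub 2)).congr_deriv ?_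
    simp only [id]; ring
  have hv : ContinuousOn v (Set.Icc 0 1) := fun x hx =>
    (hd x hx).1.continuousAt.continuousWithinAt
  have hv₁ : ContinuousOn v₁ (Set.Icc 0 1) := fun x hx =>
    (hd x hx).2.continuousAt.continuousWithinAt
  refine ⟨fun x hx => ?_, fun x hx => ?_, ?_, ?_, fun x hx => ?_, fun x hx => ?_, ?_, ?_,
    fun x hx => ?_⟩
  · refine ((((hqd x).const_mul (((m : ℝ) + 1) / m)).mul (hd x hx).1.exp).sub_const 1).congr_deriv
      ?_
    simp only [phaseFstDeriv, phaseSnd]; ring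
  · have h1 : HasDerivAt (fun x : ℝ => 2 * (1 - x)) (-2) x := by
      simpa using ((hasDerivAt_id x).const_sub 1).const_mul 2
    refine (((hqd x).mul (hd x hx).2).add h1).congr_deriv ?_
    simp only [phaseSndDeriv]
    linear_combination hode x hx
  · unfold phaseFstDeriv phaseSnd; fun_prop
  · unfold phaseSndDeriv; fun_prop
  · simp only [phaseFstDeriv, phaseFst]; ring
  · simp only [phaseSndDeriv, phaseFst, phaseSnd]; field_simp; ring
  · simp [phaseFst]
  · simp [phaseSnd]
  · have := IsPhaseCurve.mul_pos_of_mem hx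
    have : 0 < ((m : ℝ) + 1) / m * (x * (2 - x)) * Real.exp (v x) := by positivity
    rw [phaseFst]; linarith

/-- The natural length scale at the pole is `e^{-a}`: since `|v₁| ≤ C e^a`, the solution stays
within `C` of `a` up to that point, and `x e^v` and `x v₁` are of order one there. The bound does
not involve `a`. -/
theorem phaseEnergy_exp_neg_le (hm : 1 ≤ m) {a : ℝ} (ha : 0 < a) {v v₁ : ℝ → ℝ}
    (hd : ∀ x ∈ Set.Icc (0 : ℝ) 1, HasDerivAt v (v₁ x) x) (hv0 : v 0 = a)
    (hb : ∀ x ∈ Set.Icc (0 : ℝ) 1, v x ≤ a ∧ |v₁ x| ≤ C * Real.exp a) :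
    phaseEnergy m (phaseFst m v) (phaseSnd v₁) (Real.exp (-a)) ≤
      (2 * C + 2) ^ 2 / 2 + 2 * m * (4 + C) := by
  have hm0 : (0 : ℝ) < m := by exact_mod_cast hm
  have hm1 : (1 : ℝ) ≤ m := by exact_mod_cast hm
  set x := Real.exp (-a) with hx
  have hx0 : 0 < x := Real.exp_pos _
  have hx1 : x ≤ 1 := Real.exp_le_one_iff.2 (by linarith)
  have hxI : x ∈ Set.Icc (0 : ℝ) 1 := ⟨hx0.le, hx1⟩
  have hxe : Real.exp a * x = 1 := by rw [hx, ← Real.exp_add]; simp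
  have hlow : a - C ≤ v x := by
    have := (convex_Icc (0 : ℝ) 1).norm_image_sub_le_of_norm_hasDerivWithin_le
      (fun y hy => (hd y hy).hasDerivWithinAt) (fun y hy => (hb y hy).2)
      (Set.left_mem_Icc.2 zero_le_one) hxI
    rw [sub_zero, hv0, Real.norm_eq_abs, Real.norm_eq_abs, abs_of_pos hx0, mul_assoc, hxe,
      mul_one] at this
    linarith [(abs_le.1 this).1]
  have hk1 : 1 ≤ ((m : ℝ) + 1) / m := by rw [le_div_iff₀ hm0]; linarith
  have hk2 : ((m : ℝ) + 1) / m ≤ 2 := by rw [div_le_iff₀ hm0]; linarith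
  have hP : phaseSnd v₁ x ^ 2 ≤ (2 * C + 2) ^ 2 := by
    refine sq_le_sq' ?_ ?_ <;> rw [phaseSnd]
    all_goals
      have h1 : |x * (2 - x) * v₁ x| ≤ 2 * C := by
        rw [abs_mul, abs_mul, abs_of_pos hx0, abs_of_nonneg (by linarith : 0 ≤ 2 - x)]
        calc x * (2 - x) * |v₁ x| ≤ x * 2 * (C * Real.exp a) := by
              gcongr
              · linarith
              · exact (hb x hxI).2
          _ = 2 * C * (Real.exp a * x) := by ring
          _ = 2 * C := by rw [hxe, mul_one]
      have := abs_le.1 h1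
      linarith [this.1, this.2]
  have hA : phaseFst m v x ≤ 4 := by
    have : ((m : ℝ) + 1) / m * (x * (2 - x)) * Real.exp (v x) ≤ 2 * (x * 2) * Real.exp a := by
      gcongr
      · exact mul_nonneg hx0.le (by linarith)
      · linarith
      · exact (hb x hxI).1
    rw [phaseFst]; linarith
  have hlog : -C ≤ Real.log (1 + phaseFst m v x) := by
    have h1 : Real.exp (-C) ≤ 1 + phaseFst m v x := by
      have h2 : Real.exp (-C) = 1 * (x * 1) * Real.exp (a - C) := by
        rw [hx, one_mul, mul_one, ← Real.exp_add]; ring_nf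
      have h3 : 1 * (x * 1) * Real.exp (a - C)
          ≤ ((m : ℝ) + 1) / m * (x * (2 - x)) * Real.exp (v x) := by
        have : 0 ≤ x * (2 - x) := mul_nonneg hx0.le (by linarith)
        gcongr
        linarith
      rw [phaseFst]; linarith
    rw [Real.le_log_iff_exp_le ((Real.exp_pos _).trans_le h1)]
    exact h1
  rw [phaseEnergy]
  gcongr
  linarith

/-- Among the regular solutions there are some with arbitrarily large value at the pole that
satisfy the Neumann condition at the equator. -/
theorem exists_gt_deriv_one_eq_zero (hm : 1 ≤ m) (hm7 : m ≤ 7) (hC : 0 ≤ C)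
    (hV : Continuous (Function.uncurry V)) (hV₁ : Continuous (Function.uncurry V₁))
    (hV0 : ∀ a, V a 0 = a)
    (h : ∀ a, 0 < a → ∃ V₂ : ℝ → ℝ,
        (∀ x ∈ Set.Icc (0 : ℝ) 1, HasDerivAt (V a) (V₁ a x) x ∧ HasDerivAt (V₁ a) (V₂ x) x) ∧
        (∀ x ∈ Set.Icc (0 : ℝ) 1, x * (2 - x) * V₂ x + ((m : ℝ) + 2) * (1 - x) * V₁ a x
          + 2 * ((m : ℝ) + 1) * (Real.exp (V a x) - 1) = 0) ∧
        ∀ x ∈ Set.Icc (0 : ℝ) 1, V a x ≤ a ∧ |V₁ a x| ≤ C * Real.exp a)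
    {b : ℝ} (hb : 1 ≤ b) : ∃ a, b < a ∧ V₁ a 1 = 0 := by
  have hm1 : (1 : ℝ) ≤ m := by exact_mod_cast hm
  have hm7' : (m : ℝ) ≤ 7 := by exact_mod_cast hm7
  have hcurve : ∀ a, 0 < a → IsPhaseCurve m (phaseFst m (V a)) (phaseSnd (V₁ a))
      (phaseFstDeriv m (V a) (V₁ a)) (phaseSndDeriv m (V a) (V₁ a)) := fun a ha => by
    obtain ⟨V₂, h1, h2, -⟩ := h a ha
    exact isPhaseCurve_of_ode hm h1 h2
  set t : ℝ → ℝ := fun a => phaseAngle (phaseFst m (V a)) (phaseSnd (V₁ a))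
      (phaseFstDeriv m (V a) (V₁ a)) (phaseSndDeriv m (V a) (V₁ a)) 1 with ht
  -- The curve is known to avoid the origin only for `a > 0`; `max a 1` gives global continuity
  -- without changing anything on `[1, ∞)`.
  have hrate : Continuous (Function.uncurry fun a x => angleRate (phaseFst m (V (max a 1)))
      (phaseSnd (V₁ (max a 1))) (phaseFstDeriv m (V (max a 1)) (V₁ (max a 1)))
      (phaseSndDeriv m (V (max a 1)) (V₁ (max a 1))) x) := by
    have e1 : Continuous fun p : ℝ × ℝ => V (max p.1 1) (max 0 (min p.2 1)) :=
      hV.comp (by fun_prop : Continuous fun p : ℝ × ℝ => (max p.1 1, max 0 (min p.2 1)))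
    have e2 : Continuous fun p : ℝ × ℝ => V₁ (max p.1 1) (max 0 (min p.2 1)) :=
      hV₁.comp (by fun_prop : Continuous fun p : ℝ × ℝ => (max p.1 1, max 0 (min p.2 1)))
    have hne : ∀ p : ℝ × ℝ, phaseFst m (V (max p.1 1)) (max 0 (min p.2 1)) ^ 2
        + phaseSnd (V₁ (max p.1 1)) (max 0 (min p.2 1)) ^ 2 ≠ 0 := fun p =>
      (hcurve (max p.1 1) (by positivity)).ne_zero hm1 (clamp_mem p.2)
    refine Continuous.div ?_ ?_ hne
    · simp only [phaseFst, phaseSnd, phaseFstDeriv, phaseSndDeriv]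
      fun_prop
    · simp only [phaseFst, phaseSnd]
      fun_prop
  have htc : ContinuousOn t (Set.Ici 1) := by
    have h1 := (intervalIntegral.continuous_parametric_intervalIntegral_of_continuous'
      (μ := MeasureTheory.volume) hrate 0 1).const_add (Real.pi - Real.arctan 2)
    refine h1.continuousOn.congr fun a ha => ?_
    simp only [ht, phaseAngle]
    rw [max_eq_left (Set.mem_Ici.1 ha)]
  have hm0 : (0 : ℝ) ≤ m := by linarith
  -- The strict inequality `k * π < t b` is what rules out `a = b` at the end.
  obtain ⟨k, hk⟩ := exists_int_lt (t b / Real.pi)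
  rw [lt_div_iff₀ Real.pi_pos] at hk
  obtain ⟨x₁, hx₁, hsmall⟩ := IsPhaseCurve.exists_angle_one_le hm1 hm7'
    (B := (2 * C + 2) ^ 2 / 2 + 2 * m * (4 + C)) (by positivity) (k * Real.pi)
  obtain ⟨c, hc1, hc2⟩ : ∃ c, b ≤ c ∧ Real.exp (-c) < x₁ := by
    have := (Real.tendsto_exp_neg_atTop_nhds_zero.eventually (gt_mem_nhds hx₁)).and
      (Filter.eventually_ge_atTop b)
    obtain ⟨c, h1, h2⟩ := this.exists
    exact ⟨c, h2, h1⟩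
  have hcpos : 0 < c := by linarith
  have htc2 : t c ≤ k * Real.pi := by
    obtain ⟨V₂, h1, h2, h3⟩ := h c hcpos
    exact hsmall _ _ _ _ (hcurve c hcpos) _ (Real.exp_pos _) hc2
      (phaseEnergy_exp_neg_le hm hcpos (fun x hx => (h1 x hx).1) (hV0 c) h3)
  obtain ⟨a, ha, hta⟩ := intermediate_value_Icc' hc1
    (htc.mono fun x hx => hb.trans hx.1) ⟨htc2, hk.le⟩
  have hab : b < a := by
    rcases ha.1.eq_or_lt with h1 | h1
    · rw [← h1] at hta; linarith
    · exact h1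
  refine ⟨a, hab, ?_⟩
  have hap : 0 < a := by linarith
  -- At an angle in `πℤ` the sine vanishes and the cosine does not, so `P 1 = 0`; at `x = 1` the
  -- coordinate `P` is the derivative itself.
  have h1 := (hcurve a hap).snd_mul_cos_eq hm1 (Set.right_mem_Icc.2 zero_le_one)
  have h2 : phaseAngle (phaseFst m (V a)) (phaseSnd (V₁ a))
      (phaseFstDeriv m (V a) (V₁ a)) (phaseSndDeriv m (V a) (V₁ a)) 1 = k * Real.pi := hta
  rw [h2, Real.sin_int_mul_pi, mul_zero] at h1
  have h3 : Real.cos (k * Real.pi) ≠ 0 := by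
    intro h4
    have := Real.sin_sq_add_cos_sq (k * Real.pi)
    rw [h4, Real.sin_int_mul_pi] at this
    norm_num at this
  have h5 := (mul_eq_zero.1 h1).resolve_right h3
  simpa [phaseSnd, show (2 : ℝ) - 1 = 1 by norm_num] using h5

end Family

/-! ### Axially symmetric functions and their Laplacian -/

theorem contDiffOn_two_of_hasDerivAt {f f₁ f₂ : ℝ → ℝ} {s : Set ℝ} (hs : IsOpen s)
    (h : ∀ c ∈ s, HasDerivAt f (f₁ c) c) (h₁ : ∀ c ∈ s, HasDerivAt f₁ (f₂ c) c)
    (h₂ : ContinuousOn f₂ s) : ContDiffOn ℝ 2 f s := by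
  have e : (2 : WithTop ℕ∞) = 1 + 1 := by norm_num
  have hf₁ : ContDiffOn ℝ 1 f₁ s := by
    rw [show (1 : WithTop ℕ∞) = 0 + 1 by norm_num, contDiffOn_succ_iff_deriv_of_isOpen hs]
    refine ⟨fun c hc => (h₁ c hc).differentiableAt.differentiableWithinAt, by simp, ?_⟩
    rw [contDiffOn_zero]
    exact h₂.congr fun c hc => (h₁ c hc).deriv
  rw [e, contDiffOn_succ_iff_deriv_of_isOpen hs]
  exact ⟨fun c hc => (h c hc).differentiableAt.differentiableWithinAt, by simp,
    hf₁.congr fun c hc => (h c hc).deriv⟩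

/-- Reduces the second differential on the diagonal, which is all the Laplacian needs, to two
one-variable derivatives along lines. -/
theorem iteratedFDeriv_two_eq_of_hasDerivAt {E : Type*} [NormedAddCommGroup E] [NormedSpace ℝ E]
    {g D : E → ℝ} {X v : E} {d : ℝ} (hg : ContDiffAt ℝ 2 g X)
    (h₁ : ∀ᶠ Y in nhds X, HasDerivAt (fun s : ℝ => g (Y + s • v)) (D Y) 0)
    (h₂ : HasDerivAt (fun s : ℝ => D (X + s • v)) d 0) :
    iteratedFDeriv ℝ 2 g X ![v, v] = d := by
  have hline : ∀ Y : E, HasDerivAt (fun s : ℝ => Y + s • v) v 0 := fun Y => by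
    simpa using ((hasDerivAt_id (0 : ℝ)).smul_const v).const_add Y
  have hD : ∀ᶠ Y in nhds X, fderiv ℝ g Y v = D Y := by
    have hdiff : ∀ᶠ Y in nhds X, DifferentiableAt ℝ g Y :=
      (hg.eventually (by simp)).mono fun Y hY => hY.differentiableAt (by norm_num)
    filter_upwards [h₁, hdiff] with Y hY hY'
    have h0 : HasDerivAt (fun s : ℝ => g (Y + s • v)) (fderiv ℝ g Y v) 0 :=
      hY'.hasFDerivAt.comp_hasDerivAt_of_eq (f := fun s : ℝ => Y + s • v) 0 (hline Y) (by simp)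
    exact h0.unique hY
  have hf2 : HasDerivAt (fun s : ℝ => fderiv ℝ g (X + s • v)) (fderiv ℝ (fderiv ℝ g) X v) 0 :=
    ((hg.fderiv_right (m := 1) (by norm_num)).differentiableAt
      (by norm_num)).hasFDerivAt.comp_hasDerivAt_of_eq (f := fun s : ℝ => X + s • v) 0 (hline X)
      (by simp)
  have h3 : HasDerivAt (fun s : ℝ => fderiv ℝ g (X + s • v) v)
      (fderiv ℝ (fderiv ℝ g) X v v) 0 := by
    have := hf2.clm_apply (hasDerivAt_const (0 : ℝ) v)
    simpa using this
  have hcont : Filter.Tendsto (fun s : ℝ => X + s • v) (nhds 0) (nhds X) := by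
    have := (hline X).continuousAt.tendsto
    simpa using this
  have h4 := h₂.congr_of_eventuallyEq (hcont.eventually hD)
  rw [iteratedFDeriv_two_apply]
  exact h3.unique h4

section Cone

variable {N : ℕ} (i : Fin N) (f : ℝ → ℝ)

/-- The function `-2 log R + log (2 (N - 2)) + f (cos θ)`, where `θ` is the angle to the `i`-th
coordinate axis. -/
noncomputable def axialSolution (X : EuclideanSpace ℝ (Fin N)) : ℝ :=
  -2 * Real.log ‖X‖ + Real.log (2 * ((N : ℝ) - 2)) + f (X i / ‖X‖)

theorem coord_div_norm_mem (X : EuclideanSpace ℝ (Fin N)) :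
    X i / ‖X‖ ∈ Set.Icc (-1 : ℝ) 1 := by
  rw [Set.mem_Icc, ← abs_le, abs_div, abs_norm]
  exact div_le_one_of_le₀ (PiLp.norm_apply_le X i) (norm_nonneg _)

variable {i f} {f₁ f₂ : ℝ → ℝ}

theorem contDiffAt_axialSolution (hf : ContDiffOn ℝ 2 f (Set.Ioo (-2) 2))
    {X : EuclideanSpace ℝ (Fin N)} (hX : X ≠ 0) : ContDiffAt ℝ 2 (axialSolution i f) X := by
  have hn : ‖X‖ ≠ 0 := norm_ne_zero_iff.2 hX
  have h1 : ContDiffAt ℝ 2 (fun X : EuclideanSpace ℝ (Fin N) => ‖X‖) X := contDiffAt_norm ℝ hX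
  have h2 : ContDiffAt ℝ 2 (fun X : EuclideanSpace ℝ (Fin N) => X i) X :=
    (EuclideanSpace.proj i : EuclideanSpace ℝ (Fin N) →L[ℝ] ℝ).contDiff.contDiffAt
  have h3 : ContDiffAt ℝ 2 f (X i / ‖X‖) := by
    have := coord_div_norm_mem i X
    exact hf.contDiffAt (Ioo_mem_nhds (by linarith [this.1]) (by linarith [this.2]))
  exact ((contDiffAt_const.mul (h1.log hn)).add contDiffAt_const).add
    (ContDiffAt.comp (g := f) X h3 (h2.div h1 hn))

theorem hasDerivAt_norm_line {X v : EuclideanSpace ℝ (Fin N)} (hX : X ≠ 0) :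
    HasDerivAt (fun s : ℝ => ‖X + s • v‖) (inner ℝ X v / ‖X‖) 0 := by
  have hn : 0 < ‖X‖ := norm_pos_iff.2 hX
  have hline : HasDerivAt (fun s : ℝ => X + s • v) v 0 := by
    simpa using ((hasDerivAt_id (0 : ℝ)).smul_const v).const_add X
  have h1 := hline.norm_sq.sqrt (by simpa using hX)
  simp only [zero_smul, add_zero, Real.sqrt_sq_eq_abs, abs_norm] at h1
  exact h1.congr_deriv (by field_simp)

theorem hasDerivAt_axialSolution_line (hf : ∀ c ∈ Set.Ioo (-2 : ℝ) 2, HasDerivAt f (f₁ c) c)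
    {X : EuclideanSpace ℝ (Fin N)} (v : EuclideanSpace ℝ (Fin N)) (hX : X ≠ 0) :
    HasDerivAt (fun s : ℝ => axialSolution i f (X + s • v))
      (-2 * inner ℝ X v / ‖X‖ ^ 2 + f₁ (X i / ‖X‖) *
        (v i / ‖X‖ - X i * inner ℝ X v / ‖X‖ ^ 3)) 0 := by
  have hn : 0 < ‖X‖ := norm_pos_iff.2 hX
  have h1 := hasDerivAt_norm_line (v := v) hX
  have h2 : HasDerivAt (fun s : ℝ => (X + s • v) i) (v i) 0 := by
    simpa using ((hasDerivAt_id (0 : ℝ)).mul_const (v i)).const_add (X i)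
  have hc := coord_div_norm_mem i X
  have h3 : HasDerivAt f (f₁ (X i / ‖X‖)) ((X + (0 : ℝ) • v) i / ‖X + (0 : ℝ) • v‖) := by
    rw [zero_smul, add_zero]
    exact hf _ ⟨by linarith [hc.1], by linarith [hc.2]⟩
  have h0 : ‖X + (0 : ℝ) • v‖ ≠ 0 := by simpa using hX
  have h4 := (((h1.log h0).const_mul (-2)).add_const (Real.log (2 * ((N : ℝ) - 2)))).add
    (HasDerivAt.comp (h₂ := f) (0 : ℝ) h3 (h2.div h1 h0))
  refine h4.congr_deriv ?_
  simp only [zero_smul, add_zero]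
  field_simp

theorem iteratedFDeriv_two_axialSolution
    (hf : ∀ c ∈ Set.Ioo (-2 : ℝ) 2, HasDerivAt f (f₁ c) c)
    (hf₁ : ∀ c ∈ Set.Ioo (-2 : ℝ) 2, HasDerivAt f₁ (f₂ c) c)
    (hf₂ : ContinuousOn f₂ (Set.Ioo (-2) 2))
    {X : EuclideanSpace ℝ (Fin N)} (v : EuclideanSpace ℝ (Fin N)) (hX : X ≠ 0) :
    iteratedFDeriv ℝ 2 (axialSolution i f) X ![v, v] =
      -2 * ‖v‖ ^ 2 / ‖X‖ ^ 2 + 4 * inner ℝ X v ^ 2 / ‖X‖ ^ 4 +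
      f₂ (X i / ‖X‖) * (v i / ‖X‖ - X i * inner ℝ X v / ‖X‖ ^ 3) ^ 2 +
      f₁ (X i / ‖X‖) * (-2 * (v i * inner ℝ X v) / ‖X‖ ^ 3 - X i * ‖v‖ ^ 2 / ‖X‖ ^ 3
        + 3 * X i * inner ℝ X v ^ 2 / ‖X‖ ^ 5) := by
  have hn : 0 < ‖X‖ := norm_pos_iff.2 hX
  refine iteratedFDeriv_two_eq_of_hasDerivAt
    (contDiffAt_axialSolution (contDiffOn_two_of_hasDerivAt isOpen_Ioo hf hf₁ hf₂) hX)
    (D := fun X => -2 * inner ℝ X v / ‖X‖ ^ 2 + f₁ (X i / ‖X‖) *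
        (v i / ‖X‖ - X i * inner ℝ X v / ‖X‖ ^ 3)) ?_ ?_
  · filter_upwards [isOpen_ne.mem_nhds hX] with Y hY
    exact hasDerivAt_axialSolution_line hf v hY
  have h1 := hasDerivAt_norm_line (v := v) hX
  have h2 : HasDerivAt (fun s : ℝ => (X + s • v) i) (v i) 0 := by
    simpa using ((hasDerivAt_id (0 : ℝ)).mul_const (v i)).const_add (X i)
  have hc := coord_div_norm_mem i X
  have h3 : HasDerivAt f₁ (f₂ (X i / ‖X‖)) ((X + (0 : ℝ) • v) i / ‖X + (0 : ℝ) • v‖) := by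
    rw [zero_smul, add_zero]
    exact hf₁ _ ⟨by linarith [hc.1], by linarith [hc.2]⟩
  have h0 : ‖X + (0 : ℝ) • v‖ ≠ 0 := by simpa using hX
  have h5 : HasDerivAt (fun s : ℝ => inner ℝ (X + s • v) v) (‖v‖ ^ 2) 0 := by
    have := ((hasDerivAt_id (0 : ℝ)).mul_const (inner ℝ v v)).const_add (inner ℝ X v)
    simp only [id, one_mul] at this
    rw [real_inner_self_eq_norm_sq] at this
    refine this.congr_of_eventuallyEq (Filter.Eventually.of_forall fun s => ?_)
    simp only
    rw [inner_add_left, real_inner_smul_left, real_inner_self_eq_norm_sq]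
  have h6 := ((h5.const_mul (-2)).div (h1.pow 2) (pow_ne_zero 2 h0)).add
    ((HasDerivAt.comp (h₂ := f₁) (0 : ℝ) h3 (h2.div h1 h0)).mul
      (((hasDerivAt_const (0 : ℝ) (v i)).div h1 h0).sub
        ((h2.mul h5).div (h1.pow 3) (pow_ne_zero 3 h0))))
  refine h6.congr_deriv ?_
  simp only [zero_smul, add_zero, Pi.div_apply, Pi.sub_apply, Pi.mul_apply, Pi.pow_apply,
    Function.comp_apply]
  field_simp
  ring

theorem laplacian_axialSolution
    (hf : ∀ c ∈ Set.Ioo (-2 : ℝ) 2, HasDerivAt f (f₁ c) c)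
    (hf₁ : ∀ c ∈ Set.Ioo (-2 : ℝ) 2, HasDerivAt f₁ (f₂ c) c)
    (hf₂ : ContinuousOn f₂ (Set.Ioo (-2) 2))
    {X : EuclideanSpace ℝ (Fin N)} (hX : X ≠ 0) :
    (Δ (axialSolution i f)) X = (-2 * ((N : ℝ) - 2)
      + (1 - (X i / ‖X‖) ^ 2) * f₂ (X i / ‖X‖)
      - ((N : ℝ) - 1) * (X i / ‖X‖) * f₁ (X i / ‖X‖)) / ‖X‖ ^ 2 := by
  have hn : 0 < ‖X‖ := norm_pos_iff.2 hX
  have hsq : ∑ k, X k ^ 2 = ‖X‖ ^ 2 := by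
    rw [EuclideanSpace.norm_sq_eq]; simp
  have hterm : ∀ k : Fin N, iteratedFDeriv ℝ 2 (axialSolution i f) X
      ![EuclideanSpace.basisFun (Fin N) ℝ k, EuclideanSpace.basisFun (Fin N) ℝ k] =
      (-2 / ‖X‖ ^ 2 - f₁ (X i / ‖X‖) * X i / ‖X‖ ^ 3) +
      (4 / ‖X‖ ^ 4 + f₂ (X i / ‖X‖) * X i ^ 2 / ‖X‖ ^ 6 + 3 * f₁ (X i / ‖X‖) * X i / ‖X‖ ^ 5)
        * X k ^ 2 +
      (if k = i then f₂ (X i / ‖X‖) * (1 / ‖X‖ ^ 2 - 2 * X i ^ 2 / ‖X‖ ^ 4)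
        - 2 * f₁ (X i / ‖X‖) * X i / ‖X‖ ^ 3 else 0) := by
    intro k
    rw [iteratedFDeriv_two_axialSolution hf hf₁ hf₂ _ hX]
    have e1 : inner ℝ X (EuclideanSpace.basisFun (Fin N) ℝ k) = X k := by
      simp [EuclideanSpace.inner_single_right]
    have e2 : ‖EuclideanSpace.basisFun (Fin N) ℝ k‖ = 1 := by simp
    have e3 : (EuclideanSpace.basisFun (Fin N) ℝ k) i = if k = i then 1 else 0 := by
      simp [EuclideanSpace.basisFun_apply, eq_comm]
    rw [e1, e2, e3]
    split_ifs with hki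
    · subst hki
      field_simp
      ring
    · field_simp
      ring
  rw [InnerProductSpace.laplacian_eq_iteratedFDeriv_orthonormalBasis _ (EuclideanSpace.basisFun (Fin N) ℝ)]
  simp only [hterm]
  rw [Finset.sum_add_distrib, Finset.sum_add_distrib, ← Finset.mul_sum, hsq, Finset.sum_ite_eq']
  simp only [Finset.sum_const, Finset.card_univ, Fintype.card_fin, nsmul_eq_mul, Finset.mem_univ,
    if_true]
  field_simp
  ring

theorem isSolution_axialSolution (hN : 2 < N)
    (hf : ∀ c ∈ Set.Ioo (-2 : ℝ) 2, HasDerivAt f (f₁ c) c)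
    (hf₁ : ∀ c ∈ Set.Ioo (-2 : ℝ) 2, HasDerivAt f₁ (f₂ c) c)
    (hf₂ : ContinuousOn f₂ (Set.Ioo (-2) 2))
    (hode : ∀ c ∈ Set.Icc (-1 : ℝ) 1, (1 - c ^ 2) * f₂ c - ((N : ℝ) - 1) * c * f₁ c
      + 2 * ((N : ℝ) - 2) * (Real.exp (f c) - 1) = 0) :
    IsSolutionAwayFromOrigin (axialSolution i f) := by
  refine ⟨fun X hX => (contDiffAt_axialSolution (contDiffOn_two_of_hasDerivAt isOpen_Ioo hf hf₁ hf₂)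
    hX).contDiffWithinAt, fun X hX => ?_⟩
  have hn : 0 < ‖X‖ := norm_pos_iff.2 hX
  have hN' : (2 : ℝ) < N := by exact_mod_cast hN
  have hexp : Real.exp (axialSolution i f X) =
      2 * ((N : ℝ) - 2) * Real.exp (f (X i / ‖X‖)) / ‖X‖ ^ 2 := by
    rw [axialSolution, Real.exp_add, Real.exp_add, Real.exp_log (by linarith),
      show -2 * Real.log ‖X‖ = -(Real.log (‖X‖ ^ 2)) by rw [Real.log_pow]; push_cast; ring,
      Real.exp_neg, Real.exp_log (by positivity)]
    field_simp
  rw [laplacian_axialSolution hf hf₁ hf₂ hX, hexp, ← add_div, div_eq_zero_iff]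
  left
  linear_combination hode _ (coord_div_norm_mem i X)

end Cone

/-! ### Even reflection through the equator -/

theorem hasDerivAt_ite_nonneg {p q p' q' : ℝ → ℝ} {b : ℝ} (h₀ : p 0 = q 0) (h₀' : p' 0 = q' 0)
    (hp : ∀ c, 0 ≤ c → c < b → HasDerivAt p (p' c) c)
    (hq : ∀ c, -b < c → c ≤ 0 → HasDerivAt q (q' c) c) {c : ℝ} (hc : c ∈ Set.Ioo (-b) b) :
    HasDerivAt (fun c => if 0 ≤ c then p c else q c) (if 0 ≤ c then p' c else q' c) c := by
  rcases lt_trichotomy c 0 with h | h | h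
  · rw [if_neg (not_le.2 h)]
    refine (hq c hc.1 h.le).congr_of_eventuallyEq ?_
    filter_upwards [Iio_mem_nhds h] with z hz
    rw [if_neg (not_le.2 hz)]
  · subst h
    rw [if_pos le_rfl]
    have hb : 0 < b := hc.2
    have h1 : HasDerivWithinAt (fun c => if 0 ≤ c then p c else q c) (p' 0) (Set.Ici 0) 0 :=
      (hp 0 le_rfl hb).hasDerivWithinAt.congr (fun z hz => if_pos hz) (if_pos le_rfl)
    have h2 : HasDerivWithinAt (fun c => if 0 ≤ c then p c else q c) (p' 0) (Set.Iic 0) 0 := by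
      rw [h₀']
      refine (hq 0 hc.1 le_rfl).hasDerivWithinAt.congr (fun z hz => ?_) (by simp [h₀])
      rcases (Set.mem_Iic.1 hz).eq_or_lt with hz | hz
      · subst hz; simp [h₀]
      · exact if_neg (not_le.2 hz)
    have := h1.union h2
    rwa [Set.union_comm, Set.Iic_union_Ici, hasDerivWithinAt_univ] at this
  · rw [if_pos h.le]
    refine (hp c h.le hc.2).congr_of_eventuallyEq ?_
    filter_upwards [Ioi_mem_nhds h] with z hz
    rw [if_pos (Set.mem_Ioi.1 hz).le]

/-- A solution on a hemisphere that satisfies the Neumann condition at the equator extends to the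
sphere by reflection, as a function of `c = cos θ`. -/
theorem exists_even_extension {m : ℕ} {a : ℝ} (ha : 0 < a) {v v₁ v₂ : ℝ → ℝ} (hv₂ : Continuous v₂)
    (hd : ∀ x ∈ Set.Ioo (-1 : ℝ) (3 / 2), HasDerivAt v (v₁ x) x ∧ HasDerivAt v₁ (v₂ x) x)
    (hode : ∀ x ∈ Set.Icc (0 : ℝ) 1, x * (2 - x) * v₂ x + ((m : ℝ) + 2) * (1 - x) * v₁ x
          + 2 * ((m : ℝ) + 1) * (Real.exp (v x) - 1) = 0)
    (hv0 : v 0 = a) (hle : ∀ x ∈ Set.Icc (0 : ℝ) 1, v x ≤ a) (hv1 : v₁ 1 = 0) :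
    ∃ f f₁ f₂ : ℝ → ℝ, (∀ c ∈ Set.Ioo (-2 : ℝ) 2, HasDerivAt f (f₁ c) c) ∧
      (∀ c ∈ Set.Ioo (-2 : ℝ) 2, HasDerivAt f₁ (f₂ c) c) ∧ ContinuousOn f₂ (Set.Ioo (-2) 2) ∧
      (∀ c ∈ Set.Icc (-1 : ℝ) 1, (1 - c ^ 2) * f₂ c - ((m : ℝ) + 2) * c * f₁ c
        + 2 * ((m : ℝ) + 1) * (Real.exp (f c) - 1) = 0) ∧
      f 1 = a ∧ (∀ c ∈ Set.Icc (-1 : ℝ) 1, f c ≤ a) ∧ ∃ c ∈ Set.Icc (-1 : ℝ) 1, f c ≠ f 1 := by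
  have hpos : ∀ {g g' : ℝ → ℝ}, (∀ x ∈ Set.Ioo (-1 : ℝ) (3 / 2), HasDerivAt g (g' x) x) →
      ∀ c : ℝ, 0 ≤ c → c < 2 → HasDerivAt (fun c => g (1 - c)) (-g' (1 - c)) c := by
    intro g g' hg c h0 h2
    have := (hg (1 - c) ⟨by linarith, by linarith⟩).comp c ((hasDerivAt_id c).const_sub 1)
    simpa [Function.comp_def] using this
  have hneg : ∀ {g g' : ℝ → ℝ}, (∀ x ∈ Set.Ioo (-1 : ℝ) (3 / 2), HasDerivAt g (g' x) x) →
      ∀ c : ℝ, -2 < c → c ≤ 0 → HasDerivAt (fun c => g (1 + c)) (g' (1 + c)) c := by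
    intro g g' hg c h0 h2
    have := (hg (1 + c) ⟨by linarith, by linarith⟩).comp c ((hasDerivAt_id c).const_add 1)
    simpa [Function.comp_def] using this
  have hd0 : ∀ x ∈ Set.Ioo (-1 : ℝ) (3 / 2), HasDerivAt v (v₁ x) x := fun x hx => (hd x hx).1
  have hd1 : ∀ x ∈ Set.Ioo (-1 : ℝ) (3 / 2), HasDerivAt v₁ (v₂ x) x := fun x hx => (hd x hx).2
  set f : ℝ → ℝ := fun c => if 0 ≤ c then v (1 - c) else v (1 + c) with hf
  set f₁ : ℝ → ℝ := fun c => if 0 ≤ c then -v₁ (1 - c) else v₁ (1 + c) with hf₁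
  set f₂ : ℝ → ℝ := fun c => if 0 ≤ c then v₂ (1 - c) else v₂ (1 + c) with hf₂
  have hfd : ∀ c ∈ Set.Ioo (-2 : ℝ) 2, HasDerivAt f (f₁ c) c := fun c hc =>
    hasDerivAt_ite_nonneg (by simp) (by simp [hv1]) (hpos hd0) (hneg hd0) hc
  have hf1 : f 1 = a := by simp [hf, hv0]
  refine ⟨f, f₁, f₂, hfd, fun c hc => ?_, ?_, fun c hc => ?_, hf1, fun c hc => ?_, ?_⟩
  · refine hasDerivAt_ite_nonneg (p := fun c => -v₁ (1 - c)) (q := fun c => v₁ (1 + c))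
      (p' := fun c => v₂ (1 - c)) (q' := fun c => v₂ (1 + c)) (by simp [hv1]) (by simp) (fun c h0 h2 => ?_) (hneg hd1) hc
    have := (hpos hd1 c h0 h2).neg
    rw [neg_neg] at this
    exact this
  · have : f₂ = fun c => v₂ (1 - |c|) := by
      funext c
      simp only [hf₂]
      split_ifs with h
      · rw [abs_of_nonneg h]
      · rw [abs_of_neg (not_le.1 h), sub_neg_eq_add]
    rw [this]
    fun_prop
  · simp only [hf, hf₁, hf₂]
    split_ifs with h
    · linear_combination hode (1 - c) ⟨by linarith [hc.2], by linarith⟩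
    · linear_combination hode (1 + c) ⟨by linarith [hc.1], by linarith⟩
  · simp only [hf]
    split_ifs with h
    · exact hle _ ⟨by linarith [hc.2], by linarith⟩
    · exact hle _ ⟨by linarith [hc.1], by linarith⟩
  -- A constant `f` would have zero derivative at the pole, where the equation reads `(m+2) v₁(0) =
  -- -2(m+1)(e^a - 1)`, which is nonzero.
  · by_contra hcon
    push Not at hcon
    have h1 : HasDerivWithinAt f 0 (Set.Icc (-1) 1) 1 :=
      (hasDerivWithinAt_const (1 : ℝ) (Set.Icc (-1) 1) (f 1)).congr hcon rfl
    have h2 := (hfd 1 ⟨by norm_num, by norm_num⟩).hasDerivWithinAt (s := Set.Icc (-1) 1)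
    have h3 := (uniqueDiffOn_Icc (by norm_num : (-1 : ℝ) < 1) 1 (by simp)).eq_deriv _ h2 h1
    have h4 : v₁ 0 = 0 := by simpa [hf₁] using h3
    have h5 := hode 0 (by simp)
    rw [h4, hv0] at h5
    have h6 := Real.one_lt_exp_iff.2 ha
    have h7 : 0 < 2 * ((m : ℝ) + 1) * (Real.exp a - 1) := by
      have : 0 < Real.exp a - 1 := by linarith
      positivity
    linarith

/-! ### Singularity, nonradiality and congruence -/

section Cone

variable {N : ℕ} {i : Fin N} {f : ℝ → ℝ}

theorem axialSolution_of_norm_eq_one {X : EuclideanSpace ℝ (Fin N)} (hX : ‖X‖ = 1) :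
    axialSolution i f X = Real.log (2 * ((N : ℝ) - 2)) + f (X i) := by
  simp [axialSolution, hX]

theorem exists_mem_sphere_coord_eq (i : Fin N) {k : Fin N} (hk : k ≠ i) {c : ℝ}
    (hc : c ∈ Set.Icc (-1 : ℝ) 1) : ∃ X : EuclideanSpace ℝ (Fin N), ‖X‖ = 1 ∧ X i = c := by
  refine ⟨c • EuclideanSpace.single i (1 : ℝ) + √(1 - c ^ 2) • EuclideanSpace.single k (1 : ℝ),
    ?_, by simp [hk.symm]⟩
  have h1 : 0 ≤ 1 - c ^ 2 := by nlinarith [hc.1, hc.2]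
  have h2 : ‖c • EuclideanSpace.single i (1 : ℝ)
      + √(1 - c ^ 2) • EuclideanSpace.single k (1 : ℝ)‖ ^ 2 = 1 := by
    have h3 : inner ℝ (EuclideanSpace.single i (1 : ℝ)) (EuclideanSpace.single k (1 : ℝ)) = 0 := by
      simp [EuclideanSpace.inner_single_left, hk.symm]
    rw [norm_add_sq_real, norm_smul, norm_smul, real_inner_smul_left, real_inner_smul_right, h3]
    simp [Real.sq_sqrt h1]
  exact (pow_eq_one_iff_of_nonneg (norm_nonneg _) two_ne_zero).1 h2

theorem isSingularAtOrigin_axialSolution (hf : ContinuousOn f (Set.Icc (-1) 1)) :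
    IsSingularAtOrigin (axialSolution i f) := by
  obtain ⟨b, hb⟩ := isCompact_Icc.exists_bound_of_continuousOn hf
  have h1 : Filter.Tendsto (fun X : EuclideanSpace ℝ (Fin N) => Real.log ‖X‖)
      (nhdsWithin 0 {0}ᶜ) Filter.atBot :=
    Real.tendsto_log_nhdsGT_zero.comp tendsto_norm_nhdsNE_zero
  have h2 := Filter.tendsto_atTop_add_const_right _ (Real.log (2 * ((N : ℝ) - 2)) + -b)
    (h1.const_mul_atBot_of_neg (by norm_num : (-2 : ℝ) < 0))
  refine Filter.tendsto_atTop_mono (fun X => ?_) h2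
  have := (abs_le.1 (hb _ (coord_div_norm_mem i X))).1
  rw [axialSolution]
  linarith

theorem hasSeparatedForm_axialSolution :
    HasSeparatedForm (axialSolution i f)
      fun σ => f ((σ : EuclideanSpace ℝ (Fin N)) i) := by
  intro R σ hR
  have hσ : ‖(σ : EuclideanSpace ℝ (Fin N))‖ = 1 := by simp
  have hn : ‖R • (σ : EuclideanSpace ℝ (Fin N))‖ = R := by
    rw [norm_smul, hσ, mul_one, Real.norm_of_nonneg hR.le]
  rw [axialSolution, hn]
  congr 2
  simp [hR.ne']

theorem not_isRadial_axialSolution {k : Fin N} (hk : k ≠ i)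
    (hf : ∃ c ∈ Set.Icc (-1 : ℝ) 1, f c ≠ f 1) :
    ¬ IsRadialAwayFromOrigin (axialSolution i f) := by
  rintro ⟨F, hF⟩
  obtain ⟨c, hc, hne⟩ := hf
  obtain ⟨X, hX, hXc⟩ := exists_mem_sphere_coord_eq i hk hc
  obtain ⟨Y, hY, hYc⟩ := exists_mem_sphere_coord_eq i hk (c := 1) (by simp)
  have h1 := hF X (norm_ne_zero_iff.1 (by rw [hX]; exact one_ne_zero))
  have h2 := hF Y (norm_ne_zero_iff.1 (by rw [hY]; exact one_ne_zero))
  rw [axialSolution_of_norm_eq_one hX, hX, hXc] at h1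
  rw [axialSolution_of_norm_eq_one hY, hY, hYc] at h2
  exact hne (by linarith)

/-- Linear isometries preserve the unit sphere, so the value at the pole of one solution is attained
on the sphere by the other. Used in both directions, it shows that congruent solutions have the same
maximum. -/
theorem le_of_congruent_axialSolution {k : Fin N} (hk : k ≠ i) {g : ℝ → ℝ} {b : ℝ}
    (hg : ∀ c ∈ Set.Icc (-1 : ℝ) 1, g c ≤ b)
    (Q : EuclideanSpace ℝ (Fin N) ≃ₗᵢ[ℝ] EuclideanSpace ℝ (Fin N))
    (h : ∀ X : EuclideanSpace ℝ (Fin N), X ≠ 0 → axialSolution i f X = axialSolution i g (Q X)) :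
    f 1 ≤ b := by
  obtain ⟨X, hX, hXc⟩ := exists_mem_sphere_coord_eq i hk (c := 1) (by simp)
  have hQ : ‖Q X‖ = 1 := by rw [Q.norm_map, hX]
  have h1 := h X (norm_ne_zero_iff.1 (by rw [hX]; exact one_ne_zero))
  rw [axialSolution_of_norm_eq_one hX, axialSolution_of_norm_eq_one hQ, hXc] at h1
  have h2 := coord_div_norm_mem i (Q X)
  rw [hQ, div_one] at h2
  linarith [hg _ h2]

end Cone

/-! ### The main theorem -/

theorem theoremA (N : ℕ) (hN4 : 4 ≤ N) (hN10 : N ≤ 10) :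
    ∃ (U : ℕ → EuclideanSpace ℝ (Fin N) → ℝ)
      (V : ℕ → Metric.sphere (0 : EuclideanSpace ℝ (Fin N)) 1 → ℝ),
      (∀ j : ℕ,
        IsSolutionAwayFromOrigin (U j) ∧
        IsSingularAtOrigin (U j) ∧
        ¬ IsRadialAwayFromOrigin (U j) ∧
        HasSeparatedForm (U j) (V j) ∧
        ∃ σ τ : Metric.sphere (0 : EuclideanSpace ℝ (Fin N)) 1, V j σ ≠ V j τ) ∧
      ∀ i j : ℕ, i ≠ j → ¬ CongruentAwayFromOrigin (U i) (U j) := by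
  obtain ⟨m, rfl⟩ : ∃ m, N = m + 3 := ⟨N - 3, by omega⟩
  obtain ⟨C, W, W₁, hC, hW, hW₁, hW0, hreg⟩ := exists_regular_family m
  set S : Set ℝ := {a | 0 < a ∧ W₁ a 1 = 0} with hS
  -- Shooting gives an admissible value beyond any bound, so the set is unbounded above.
  have hSinf : S.Infinite := by
    refine Set.infinite_of_not_bddAbove fun ⟨b, hb⟩ => ?_
    obtain ⟨a, ha, ha0⟩ := exists_gt_deriv_one_eq_zero (m := m) (by omega) (by omega) hC hW hW₁ hW0
      (fun a ha => by
        obtain ⟨W₂, -, h1, h2⟩ := hreg a ha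
        exact ⟨W₂, fun x hx => h1 x ⟨by linarith [hx.1], by linarith [hx.2]⟩, h2⟩)
      (le_max_right b 1)
    have h1 : a ∈ S := ⟨by linarith [le_max_right b 1], ha0⟩
    linarith [hb h1, le_max_left b 1]
  have : Infinite S := hSinf.to_subtype
  let e : ℕ ↪ S := Infinite.natEmbedding S
  have hext : ∀ j : ℕ, ∃ f f₁ f₂ : ℝ → ℝ, (∀ c ∈ Set.Ioo (-2 : ℝ) 2, HasDerivAt f (f₁ c) c) ∧
      (∀ c ∈ Set.Ioo (-2 : ℝ) 2, HasDerivAt f₁ (f₂ c) c) ∧ ContinuousOn f₂ (Set.Ioo (-2) 2) ∧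
      (∀ c ∈ Set.Icc (-1 : ℝ) 1, (1 - c ^ 2) * f₂ c - ((m : ℝ) + 2) * c * f₁ c
        + 2 * ((m : ℝ) + 1) * (Real.exp (f c) - 1) = 0) ∧
      f 1 = e j ∧ (∀ c ∈ Set.Icc (-1 : ℝ) 1, f c ≤ e j) ∧
      ∃ c ∈ Set.Icc (-1 : ℝ) 1, f c ≠ f 1 := fun j => by
    obtain ⟨W₂, h0, h1, h2, h3⟩ := hreg (e j) (e j).2.1
    exact exists_even_extension (e j).2.1 h0 h1 h2 (hW0 _) (fun x hx => (h3 x hx).1) (e j).2.2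
  choose f f₁ f₂ hd hd₁ hc₂ hode hf1 hfle hne using hext
  have hk : (1 : Fin (m + 3)) ≠ 0 := by simp
  refine ⟨fun j => axialSolution 0 (f j),
    fun j σ => f j ((σ : EuclideanSpace ℝ (Fin (m + 3))) 0), fun j => ⟨?_, ?_, ?_, ?_, ?_⟩, ?_⟩
  · refine isSolution_axialSolution (by omega) (hd j) (hd₁ j) (hc₂ j) fun c hc => ?_
    push_cast
    linear_combination hode j c hc
  · exact isSingularAtOrigin_axialSolution fun c hc =>
      (hd j c ⟨by linarith [hc.1], by linarith [hc.2]⟩).continuousAt.continuousWithinAt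
  · exact not_isRadial_axialSolution hk (hne j)
  · exact hasSeparatedForm_axialSolution
  · obtain ⟨c, hc, hcne⟩ := hne j
    obtain ⟨X, hX, hXc⟩ := exists_mem_sphere_coord_eq 0 hk hc
    obtain ⟨Y, hY, hYc⟩ := exists_mem_sphere_coord_eq 0 hk (c := 1) (by simp)
    refine ⟨⟨X, by simpa using hX⟩, ⟨Y, by simpa using hY⟩, ?_⟩
    simpa only [hXc, hYc] using hcne
  · rintro i j hij ⟨Q, hQ⟩
    have h1 := le_of_congruent_axialSolution hk (hfle j) Q hQ
    have h2 := le_of_congruent_axialSolution (f := f j) hk (hfle i) Q.symm fun X hX => by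
      have := hQ (Q.symm X) (by simpa using hX)
      simp only [LinearIsometryEquiv.apply_symm_apply] at this
      exact this.symm
    rw [hf1] at h1 h2
    exact hij (e.injective (Subtype.ext (le_antisymm h1 h2)))
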